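/- Let $F$ be an infinite field and let $\mathrm{GL}_4=\mathrm{GL}_4(F)$. For $l\ge 0$ let $D_l(F^4)$ be the free abelian group on the tuples $(\langle w_0\rangle,\dots,\langle w_l\rangle)$ of lines through the origin in $F^4$ such that every $\min\{l+1,2\}$ of the vectors $w_i$ are linearly independent (that is, the lines are pairwise distinct), with the natural action of $\mathrm{GL}_4$, with differential $\tilde\partial_l=\sum_{i=0}^{l}(-1)^i\tilde d_i\colon D_l(F^4)\to D_{l-1}(F^4)$ for $l\ge 1$, where $\tilde d_i$ omits the $i$-th line, and with augmentation $\tilde\partial_0\colon D_0(F^4)\to D_{-1}(F^4):=\mathbb{Z}$, the sum of the coefficients ($\mathrm{GL}_4$ acts trivially on $\mathbb{Z}$). Let $M_*$ be the complex with $M_0=\mathbb{Z}$ and $M_p=D_{p-1}(F^4)$ for $p\ge 1$, and let $P_*\to\mathbb{Z}$ be the bar resolution of the trivial $\mathrm{GL}_4$-module $\mathbb{Z}$. Consider the spectral sequence of the double complex $M_*\otimes_{\mathrm{GL}_4}P_*$ with $$\tilde E^1_{p,q}(4)=H_q(\mathrm{GL}_4,M_p),$$ whose differential $\tilde d^1$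 is induced by the differential of $M_*$; thus $\tilde E^2_{p,q}(4)$ is the homology at the $p$-th place of the complex $(\tilde E^1_{*,q}(4),\tilde d^1_{*,q})$. **Lemma 5.1.** $\tilde E^2_{p,0}(4)=0$ for $0\le p\le 6$. In particular (the case $p=6$), the complex of coinvariants $D_*(F^4)_{\mathrm{GL}_4}$ satisfies $H_5(D_*(F^4)_{\mathrm{GL}_4})=0$. -/

import Mathlib

open CategoryTheory
open scoped LinearAlgebra.Projectivization MatrixGroups MonoidAlgebra

universe u

noncomputable section

/-- The condition on the basis elements of `D_l(F^n)`: in the tuple `(w_0, …, w_l)` of lines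
through the origin of `F^n`, every `min {l + 1, 2}` of the lines are linearly independent. -/
def PairwiseGeneral {F : Type u} [Field F] {n l : ℕ} (w : Fin (l + 1) → ℙ F (Fin n → F)) : Prop :=
  ∀ s : Finset (Fin (l + 1)), s.card = min (l + 1) 2 →
    Projectivization.Independent (fun i : s => w i)

/-- Helper fact: the condition says exactly that the lines are pairwise distinct. -/
theorem pairwiseGeneral_iff_injective {F : Type u} [Field F] {n l : ℕ}
    (w : Fin (l + 1) → ℙ F (Fin n → F)) : PairwiseGeneral w ↔ Function.Injective w := by
  classical
  constructor
  · intro h i j hij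
    by_contra hne
    have hl : 1 ≤ l := by
      rcases l with _ | l
      · exact absurd (Subsingleton.elim (α := Fin 1) i j) hne
      · omega
    have hs := h {i, j} (by rw [Finset.card_pair hne]; omega)
    rw [Projectivization.independent_iff] at hs
    have := hs.injective (a₁ := ⟨i, by simp⟩) (a₂ := ⟨j, by simp⟩) (by simp [hij])
    exact hne (by simpa using this)
  · intro h s hs
    have hc : s.card = 1 ∨ s.card = 2 := by omega
    rw [Projectivization.independent_iff]
    rcases hc with hc | hc
    · obtain ⟨i, rfl⟩ := Finset.card_eq_one.1 hc
      have : Subsingleton ({i} : Finset (Fin (l + 1))) :=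
        ⟨fun a b => Subtype.ext ((Finset.mem_singleton.1 a.2).trans
          (Finset.mem_singleton.1 b.2).symm)⟩
      exact LinearIndependent.of_subsingleton ⟨i, by simp⟩ (Projectivization.rep_nonzero _)
    · obtain ⟨i, j, hij, rfl⟩ := Finset.card_eq_two.1 hc
      have key := (Projectivization.independent_pair_iff_ne (w i) (w j)).2 (fun e => hij (h e))
      rw [Projectivization.independent_iff] at key
      let f : ({i, j} : Finset (Fin (l + 1))) → Fin 2 := fun a => if a.1 = i then 0 else 1
      have hf : Function.Injective f := by
        rintro ⟨a, ha⟩ ⟨b, hb⟩ hab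
        simp only [Finset.mem_insert, Finset.mem_singleton] at ha hb
        rcases ha with rfl | rfl <;> rcases hb with rfl | rfl <;> simp_all [f]
      convert key.comp f hf using 1
      funext ⟨a, ha⟩
      simp only [Finset.mem_insert, Finset.mem_singleton] at ha
      rcases ha with rfl | rfl
      · simp [f]
      · simp [f, Ne.symm hij]

/-- The canonical basis of `D_l(F^n)`. -/
def LineTuple (F : Type u) [Field F] (n l : ℕ) : Type u :=
  {w : Fin (l + 1) → ℙ F (Fin n → F) // PairwiseGeneral w}

namespace LineTuple

/-- `GL_n(F)` acts on the tuples through its natural action on the lines of `F^n`. -/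
instance instMulAction {F : Type u} [Field F] {n l : ℕ} :
    MulAction (GL (Fin n) F) (LineTuple F n l) where
  smul g w := ⟨fun i => g • w.1 i, (pairwiseGeneral_iff_injective _).2
    ((MulAction.injective g).comp ((pairwiseGeneral_iff_injective _).1 w.2))⟩
  one_smul w := Subtype.ext (funext fun i => one_smul _ (w.1 i))
  mul_smul g h w := Subtype.ext (funext fun i => mul_smul g h (w.1 i))

/-- Omit the `i`-th line of a tuple. -/
def face {F : Type u} [Field F] {n l : ℕ} (i : Fin (l + 2)) (w : LineTuple F n (l + 1)) :
    LineTuple F n l :=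
  ⟨fun j => w.1 (i.succAbove j), (pairwiseGeneral_iff_injective _).2
    (((pairwiseGeneral_iff_injective _).1 w.2).comp Fin.succAbove_right_injective)⟩

theorem face_smul {F : Type u} [Field F] {n l : ℕ} (i : Fin (l + 2)) (g : GL (Fin n) F)
    (w : LineTuple F n (l + 1)) : face i (g • w) = g • face i w := rfl

theorem face_face {F : Type u} [Field F] {n l : ℕ} (w : LineTuple F n (l + 2))
    (i : Fin (l + 2)) (j : Fin (l + 3)) (h : (j : ℕ) ≤ (i : ℕ)) :
    face i (face j w) = face (j.castLT (lt_of_le_of_lt h i.is_lt)) (face i.succ w) := by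
  apply Subtype.ext
  funext a
  refine congrArg w.1 (Fin.ext ?_)
  simp only [Fin.succAbove, Fin.lt_def, Fin.val_castSucc, Fin.val_castLT, Fin.val_succ]
  split_ifs <;> simp_all <;> omega

end LineTuple

/-- `D_l(F^n)`, with coefficients in `k`: the free `k`-module on the tuples `(w_0, …, w_l)`, as a
representation of `GL_n(F)`. -/
abbrev lineRep (k F : Type u) [CommRing k] [Field F] (n l : ℕ) : Rep.{u} k (GL (Fin n) F) :=
  Rep.ofMulAction k (GL (Fin n) F) (LineTuple F n l)

/-- The map `D_{l+1}(F^n) → D_l(F^n)` omitting the `i`-th line of every basis element. -/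
def lineFace (k F : Type u) [CommRing k] [Field F] (n l : ℕ) (i : Fin (l + 2)) :
    lineRep k F n (l + 1) ⟶ lineRep k F n l :=
  Rep.ofHom
    { toLinearMap := MonoidAlgebra.mapDomainLinearMap k k (LineTuple.face i)
      isIntertwining' := fun g => by
        ext w
        simp [LineTuple.face_smul] }

/-- The differential `D_{l+1}(F^n) → D_l(F^n)`, the alternating sum of the face maps. -/
def lineD (k F : Type u) [CommRing k] [Field F] (n l : ℕ) :
    lineRep k F n (l + 1) ⟶ lineRep k F n l :=
  ∑ i : Fin (l + 2), (-1 : ℤ) ^ (i : ℕ) • lineFace k F n l i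

theorem lineFace_comp (k F : Type u) [CommRing k] [Field F] (n l : ℕ)
    (i : Fin (l + 2)) (j : Fin (l + 3)) (h : (j : ℕ) ≤ (i : ℕ)) :
    lineFace k F n (l + 1) j ≫ lineFace k F n l i =
      lineFace k F n (l + 1) i.succ ≫
        lineFace k F n l (j.castLT (lt_of_le_of_lt h i.is_lt)) := by
  apply Rep.hom_ext
  apply Representation.IntertwiningMap.ext
  refine MonoidAlgebra.lhom_ext' fun w => LinearMap.ext_ring ?_
  simp [lineFace, LineTuple.face_face w i j h]

theorem lineD_comp_lineD (k F : Type u) [CommRing k] [Field F] (n l : ℕ) :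
    lineD k F n (l + 1) ≫ lineD k F n l = 0 := by
  simp only [lineD, Preadditive.comp_sum, Preadditive.sum_comp, ← Finset.sum_product']
  let P := Fin (l + 2) × Fin (l + 3)
  let S : Finset P := {ij : P | (ij.2 : ℕ) ≤ (ij.1 : ℕ)}
  rw [Finset.univ_product_univ, ← Finset.sum_add_sum_compl S, ← eq_neg_iff_add_eq_zero,
    ← Finset.sum_neg_distrib]
  let φ : ∀ ij : P, ij ∈ S → P := fun ij hij =>
    (Fin.castLT ij.2 (lt_of_le_of_lt (Finset.mem_filter.mp hij).right (Fin.is_lt ij.1)),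
      ij.1.succ)
  apply Finset.sum_bij φ
  · intro ij hij
    simp_rw [S, φ, Finset.compl_filter, Finset.mem_filter_univ, Fin.val_succ,
      Fin.val_castLT] at hij ⊢
    omega
  · rintro ⟨i, j⟩ hij ⟨i', j'⟩ hij' h
    have h1 := congrArg (fun x : P => (x.1 : ℕ)) h
    have h2 := congrArg (fun x : P => (x.2 : ℕ)) h
    simp only [φ, Fin.val_castLT, Fin.val_succ] at h1 h2
    exact Prod.ext (Fin.ext (by simpa using h2)) (Fin.ext h1)
  · rintro ⟨i', j'⟩ hij'
    simp_rw [S, Finset.compl_filter, Finset.mem_filter_univ, not_le] at hij'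
    refine ⟨(j'.pred ?_, Fin.castSucc i'), ?_, ?_⟩
    · rintro rfl
      simp only [Fin.val_zero, not_lt_zero] at hij'
    · simp only [S, Finset.mem_filter_univ, Fin.val_castSucc, Fin.val_pred]
      omega
    · simp only [φ, Fin.castLT_castSucc, Fin.succ_pred]
  · rintro ⟨i, j⟩ hij
    have h : (j : ℕ) ≤ (i : ℕ) := by simpa [S] using hij
    simp only [φ, Preadditive.zsmul_comp, Preadditive.comp_zsmul, smul_smul, ← neg_smul]
    rw [lineFace_comp k F n l i j h]
    congr 1
    simp only [Fin.val_succ, Fin.val_castLT, pow_add, pow_one]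
    ring

/-- The augmentation `D_0(F^n) → D_{-1}(F^n) = k`, the sum of the coefficients. -/
def lineAug (k F : Type u) [CommRing k] [Field F] (n : ℕ) :
    lineRep k F n 0 ⟶ Rep.trivial k (GL (Fin n) F) k :=
  Rep.ofHom
    { toLinearMap := Finsupp.linearCombination k (fun _ : LineTuple F n 0 => (1 : k)) ∘ₗ
        (MonoidAlgebra.coeffLinearEquiv k).toLinearMap
      isIntertwining' := fun g => by
        ext w
        simp }

theorem lineD_comp_lineAug (k F : Type u) [CommRing k] [Field F] (n : ℕ) :
    lineD k F n 0 ≫ lineAug k F n = 0 := by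
  have h (i : Fin 2) : lineFace k F n 0 i ≫ lineAug k F n =
      lineFace k F n 0 0 ≫ lineAug k F n := by
    apply Rep.hom_ext
    apply Representation.IntertwiningMap.ext
    refine MonoidAlgebra.lhom_ext' fun w => LinearMap.ext_ring ?_
    simp [lineFace, lineAug]
  simp [lineD, Fin.sum_univ_two, h 1]

/-- The complex `D_*(F^n)`, in degrees `l ≥ 0`, of representations of `GL_n(F)`. -/
def lineComplex (k F : Type u) [CommRing k] [Field F] (n : ℕ) :
    ChainComplex (Rep.{u} k (GL (Fin n) F)) ℕ :=
  ChainComplex.of (lineRep k F n) (lineD k F n) (lineD_comp_lineD k F n)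

theorem lineComplex_d (k F : Type u) [CommRing k] [Field F] (n l : ℕ) :
    (lineComplex k F n).d (l + 1) l = lineD k F n l := by
  simp [lineComplex]

/-- The complex `M_*`, with `M_0 = k` and `M_p = D_{p-1}(F^n)` for `p ≥ 1`. -/
def augLineComplex (k F : Type u) [CommRing k] [Field F] (n : ℕ) :
    ChainComplex (Rep.{u} k (GL (Fin n) F)) ℕ :=
  (lineComplex k F n).augment (lineAug k F n)
    (by rw [lineComplex_d]; exact lineD_comp_lineAug k F n)

/-- The double complex `M_* ⊗_{GL_n} P_*`, for `P_*` the bar resolution: its `p`-th column is the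
complex of inhomogeneous chains of `GL_n(F)` with coefficients in `M_p`. -/
def lineDoubleComplex (k F : Type u) [CommRing k] [Field F] (n : ℕ) :
    ChainComplex (ChainComplex (ModuleCat.{u} k) ℕ) ℕ :=
  ((groupHomology.chainsFunctor k (GL (Fin n) F)).mapHomologicalComplex _).obj
    (augLineComplex k F n)

/-- The `q`-th row `(E^1_{*,q}, d^1_{*,q})` of the first page of the spectral sequence of a double
complex, given as the complex of its columns: `E^1_{p,q}` is the `q`-th homology of the `p`-th
column, and `d^1` is induced by the horizontal differential. -/
def pageOneRow {k : Type u} [CommRing k] (K : ChainComplex (ChainComplex (ModuleCat.{u} k) ℕ) ℕ)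
    (q : ℕ) : ChainComplex (ModuleCat.{u} k) ℕ :=
  ((HomologicalComplex.homologyFunctor (ModuleCat.{u} k) (ComplexShape.down ℕ)
    q).mapHomologicalComplex _).obj K

/-- The term `E^2_{p,q}` of the same spectral sequence: the homology of `(E^1_{*,q}, d^1_{*,q})`
at `E^1_{p,q}`. -/
def pageTwo {k : Type u} [CommRing k] (K : ChainComplex (ChainComplex (ModuleCat.{u} k) ℕ) ℕ)
    (p q : ℕ) : ModuleCat.{u} k :=
  (pageOneRow K q).homology p

/-- The complex of coinvariants `D_*(F^n)_{GL_n}`, in degrees `l ≥ 0`. -/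
def lineCoinvariants (k F : Type u) [CommRing k] [Field F] (n : ℕ) :
    ChainComplex (ModuleCat.{u} k) ℕ :=
  ((Rep.coinvariantsFunctor k (GL (Fin n) F)).mapHomologicalComplex _).obj (lineComplex k F n)

end

/-!
The coinvariants of `D_l` are free on the orbits of tuples of `l + 1` distinct lines, so exactness
at `D_l` follows if every invariant cocycle `c` on such tuples is the coboundary of an invariant
function `s` (`CocyclesAreCoboundaries`). Put `s(w) = c(v, w)`, where the line `v` is in general
position with respect to `w`. If this does not depend on `v`, the cocycle relation for `(v, w)`,
with `v` in general position with respect to a longer tuple `w`, says that `c` is the coboundary of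
`s` (`cocyclesAreCoboundaries_of_genericCone`). For at most five lines `w` in `F⁴`, all tuples
`(v, w)` lie in one orbit, except when `w` consists of five lines that span `F⁴`. So the claim is
about the value of a cocycle on six lines in `F⁴`.

Tuples of lines are classified up to `GL_n` by the linear relations of vectors spanning them, that
is, by a Gale dual: six lines in `F⁴` are dual to six vectors in `F²`, up to `GL_2` and scaling, and
omitting a line from seven lines in `F⁴` is dual to projecting seven points of the projective plane
from one of them. The cocycle relation becomes: for seven points in the plane, the alternating sum
of the values at the seven projections is zero (`IsLineCocycle.sum_galeValue_eq_zero`). Three special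
configurations suffice.

* Seven points on two lines, three on one and four on the other, show that a cocycle vanishes at
  four points with a double point in the first two or last two positions
  (`galeValue_double_first`, `galeValue_double_last`).
* Two collinear triples and a seventh point then show that a cocycle vanishes at six pairwise
  distinct points (`galeValue_affine`, `galeValue_eq_zero_of_pairwise_det`).
* Seven points, of which at most four lie on a line and the others are in general position, then
  show that the value at three or more distinct points, with all the other points at infinity, is
  independent of the positions of the former: slide one of the points on the line
  (`galeValue_pointsWithInfinity_eq`).

The dual of `(v, w)`, for five spanning lines `w` with linear relation `x`, has this last shape: at
infinity are `v` and the lines on which `x` vanishes (`LineTuple.exists_hasGaleDual_genericCone`).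
-/

/-! ### Coinvariants and the row `q = 0` of the first page -/

section

/-- The functor of coinvariants is the zeroth group homology functor. -/
noncomputable def coinvariantsIsoH0 (k G : Type u) [CommRing k] [Group G] :
    groupHomology.chainsFunctor k G ⋙ HomologicalComplex.homologyFunctor (ModuleCat.{u} k)
      (ComplexShape.down ℕ) 0 ≅ Rep.coinvariantsFunctor k G :=
  NatIso.ofComponents (fun A => groupHomology.H0Iso A)
    (fun f => groupHomology.map_id_comp_H0Iso_hom f)

/-- The complex of coinvariants of the augmented complex `M_*`. -/
noncomputable def augLineCoinvariants (k F : Type u) [CommRing k] [Field F] (n : ℕ) :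
    ChainComplex (ModuleCat.{u} k) ℕ :=
  ((Rep.coinvariantsFunctor k (GL (Fin n) F)).mapHomologicalComplex _).obj (augLineComplex k F n)

/-- The row `q = 0` of the first page is the complex of coinvariants of `M_*`. -/
noncomputable def pageOneRowZeroIso (k F : Type u) [CommRing k] [Field F] (n : ℕ) :
    pageOneRow (lineDoubleComplex k F n) 0 ≅ augLineCoinvariants k F n :=
  (NatIso.mapHomologicalComplex (coinvariantsIsoH0 k (GL (Fin n) F)) (ComplexShape.down ℕ)).app
    (augLineComplex k F n)

/-- Exactness of a chain complex of modules at degree `p + 1`, if some linear map on the `p + 1`-st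
term that kills only boundaries factors through the differential. -/
theorem exactAt_succ_of_factor {k : Type u} [CommRing k] (K : ChainComplex (ModuleCat.{u} k) ℕ)
    (p : ℕ) {M : Type*} [AddCommGroup M] [Module k M] (s : K.X p →ₗ[k] M) (t : K.X (p + 1) →ₗ[k] M)
    (h : ∀ z, s ((K.d (p + 1) p).hom z) = t z)
    (ht : ∀ z, t z = 0 → ∃ y, (K.d (p + 2) (p + 1)).hom y = z) : K.ExactAt (p + 1) := by
  rw [HomologicalComplex.exactAt_iff' K (p + 2) (p + 1) p (by simp) (by simp),
    ShortComplex.moduleCat_exact_iff]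
  exact fun z hz => ht z ((h z).symm.trans ((congrArg s hz).trans (map_zero s)))

variable {F : Type u} [Field F] {n : ℕ}

/-- A function on tuples of `l + 1` lines that is a cocycle: it is invariant under `GL_n(F)` and
vanishes on boundaries of tuples of `l + 2` lines. -/
structure IsLineCocycle {l : ℕ} {A : Type*} [AddCommGroup A] (c : LineTuple F n l → A) : Prop where
  smul : ∀ (g : GL (Fin n) F) w, c (g • w) = c w
  boundary : ∀ w : LineTuple F n (l + 1), ∑ i : Fin (l + 2), (-1 : ℤ) ^ (i : ℕ) • c (w.face i) = 0

/-- Every invariant cocycle on tuples of `l + 2` lines is the coboundary of an invariant function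
on tuples of `l + 1` lines. -/
def CocyclesAreCoboundaries (F : Type u) [Field F] (n l : ℕ) : Prop :=
  ∀ (A : Type u) [AddCommGroup A] (c : LineTuple F n (l + 1) → A), IsLineCocycle c →
    ∃ s : LineTuple F n l → A, (∀ (g : GL (Fin n) F) w, s (g • w) = s w) ∧
      ∀ w, c w = ∑ i : Fin (l + 2), (-1 : ℤ) ^ (i : ℕ) • s (w.face i)

variable (k : Type u) [CommRing k]

/-- The class of a tuple in the module of coinvariants. -/
noncomputable def lineClass {l : ℕ} (w : LineTuple F n l) :
    Representation.Coinvariants (lineRep k F n l).ρ :=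
  Representation.Coinvariants.mk _ (MonoidAlgebra.single w 1)

theorem lineClass_smul {l : ℕ} (g : GL (Fin n) F) (w : LineTuple F n l) :
    lineClass k (g • w) = lineClass k w := by
  rw [lineClass, lineClass,
    ← Representation.Coinvariants.mk_self_apply _ g (MonoidAlgebra.single w 1),
    Representation.ofMulAction_single]

theorem coinvariants_hom_ext {l : ℕ} {M : Type*} [AddCommGroup M] [Module k M]
    {f g : Representation.Coinvariants (lineRep k F n l).ρ →ₗ[k] M}
    (h : ∀ w, f (lineClass k w) = g (lineClass k w)) : f = g := by
  refine Representation.Coinvariants.hom_ext (MonoidAlgebra.lhom_ext' fun w => ?_)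
  exact LinearMap.ext_ring (h w)

/-- An invariant function on tuples extends to the coinvariants. -/
noncomputable def coinvariantsLift {l : ℕ} {M : Type*} [AddCommGroup M] [Module k M]
    (s : LineTuple F n l → M) (hs : ∀ (g : GL (Fin n) F) w, s (g • w) = s w) :
    Representation.Coinvariants (lineRep k F n l).ρ →ₗ[k] M :=
  Representation.Coinvariants.lift _
    (Finsupp.linearCombination k s ∘ₗ (MonoidAlgebra.coeffLinearEquiv k).toLinearMap)
    (fun g => MonoidAlgebra.lhom_ext' fun w => LinearMap.ext_ring (by simp [hs]))

theorem coinvariantsLift_lineClass {l : ℕ} {M : Type*} [AddCommGroup M] [Module k M]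
    (s : LineTuple F n l → M) (hs : ∀ (g : GL (Fin n) F) w, s (g • w) = s w)
    (w : LineTuple F n l) : coinvariantsLift k s hs (lineClass k w) = s w := by
  simp [coinvariantsLift, lineClass]

theorem map_lineD_lineClass {l : ℕ} (w : LineTuple F n (l + 1)) :
    Representation.Coinvariants.map _ _ (lineD k F n l).hom (lineClass k w) =
      ∑ i : Fin (l + 2), (-1 : ℤ) ^ (i : ℕ) • lineClass k (w.face i) := by
  rw [lineClass, Representation.Coinvariants.map_mk]
  have : (lineD k F n l).hom (MonoidAlgebra.single w 1) =
      ∑ i : Fin (l + 2), (-1 : ℤ) ^ (i : ℕ) • MonoidAlgebra.single (w.face i) (1 : k) := by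
    rw [lineD, Rep.sum_hom, Representation.IntertwiningMap.sum_apply]
    refine Finset.sum_congr rfl fun i _ => ?_
    rw [Rep.zsmul_hom]
    simp [lineFace]
  rw [this, map_sum]
  exact Finset.sum_congr rfl fun i _ => map_zsmul _ _ _

theorem map_lineAug_lineClass (w : LineTuple F n 0) :
    Representation.Coinvariants.map _ _ (lineAug k F n).hom (lineClass k w) =
      Representation.Coinvariants.mk (Representation.trivial k (GL (Fin n) F) k) 1 := by
  rw [lineClass, Representation.Coinvariants.map_mk]
  congr 1
  simp [lineAug]

theorem lineCoinvariants_d_hom (l : ℕ) :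
    ((lineCoinvariants k F n).d (l + 1) l).hom =
      Representation.Coinvariants.map _ _ (lineD k F n l).hom := by
  change ((Rep.coinvariantsFunctor k (GL (Fin n) F)).map ((lineComplex k F n).d (l + 1) l)).hom = _
  rw [lineComplex_d]
  rfl

theorem augLineCoinvariants_d_hom (l : ℕ) :
    ((augLineCoinvariants k F n).d (l + 2) (l + 1)).hom =
      Representation.Coinvariants.map _ _ (lineD k F n l).hom :=
  lineCoinvariants_d_hom k l

/-- If cocycles are coboundaries, the projection of the coinvariants onto the cokernel of the next
differential factors through the differential: apply the hypothesis to the tautological cocycle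
sending a tuple to its class in the cokernel. -/
theorem exists_factor {l : ℕ} (h : CocyclesAreCoboundaries F n l) :
    ∃ s : Representation.Coinvariants (lineRep k F n l).ρ →ₗ[k]
        Representation.Coinvariants (lineRep k F n (l + 1)).ρ ⧸
          LinearMap.range (Representation.Coinvariants.map _ _ (lineD k F n (l + 1)).hom),
      s ∘ₗ Representation.Coinvariants.map _ _ (lineD k F n l).hom = Submodule.mkQ _ := by
  obtain ⟨s, hs, hc⟩ := h _ (fun w => Submodule.mkQ
    (LinearMap.range (Representation.Coinvariants.map _ _ (lineD k F n (l + 1)).hom))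
    (lineClass k w))
    { smul := fun g w => by simp only [lineClass_smul]
      boundary := fun w => by
        simp only [← map_zsmul]
        rw [← map_sum, ← map_lineD_lineClass, Submodule.mkQ_apply, Submodule.Quotient.mk_eq_zero]
        exact LinearMap.mem_range_self _ _ }
  refine ⟨coinvariantsLift k s hs, coinvariants_hom_ext k fun w => ?_⟩
  rw [LinearMap.comp_apply, map_lineD_lineClass, hc, map_sum]
  refine Finset.sum_congr rfl fun i _ => ?_
  rw [map_zsmul, coinvariantsLift_lineClass]

theorem lineCoinvariants_exactAt {l : ℕ} (h : CocyclesAreCoboundaries F n l) :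
    (lineCoinvariants k F n).ExactAt (l + 1) := by
  obtain ⟨s, hs⟩ := exists_factor k h
  refine exactAt_succ_of_factor _ l s (Submodule.mkQ _) (fun z => ?_) (fun z hz => ?_)
  · rw [lineCoinvariants_d_hom]
    exact LinearMap.congr_fun hs z
  · rw [lineCoinvariants_d_hom]
    exact (Submodule.Quotient.mk_eq_zero _).1 hz

theorem augLineCoinvariants_exactAt {l : ℕ} (h : CocyclesAreCoboundaries F n l) :
    (augLineCoinvariants k F n).ExactAt (l + 2) := by
  obtain ⟨s, hs⟩ := exists_factor k h
  refine exactAt_succ_of_factor _ (l + 1) s (Submodule.mkQ _) (fun z => ?_) (fun z hz => ?_)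
  · rw [augLineCoinvariants_d_hom]
    exact LinearMap.congr_fun hs z
  · rw [augLineCoinvariants_d_hom]
    exact (Submodule.Quotient.mk_eq_zero _).1 hz

theorem augLineCoinvariants_exactAt_zero [Nonempty (LineTuple F n 0)] :
    (augLineCoinvariants k F n).ExactAt 0 := by
  rw [HomologicalComplex.exactAt_iff' _ 1 0 0 (by simp) (by simp),
    ShortComplex.moduleCat_exact_iff]
  intro z _
  obtain ⟨a, rfl⟩ := Representation.Coinvariants.mk_surjective
    (Representation.trivial k (GL (Fin n) F) k) z
  refine ⟨a • lineClass k (Classical.arbitrary (LineTuple F n 0)), ?_⟩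
  change Representation.Coinvariants.map _ _ (lineAug k F n).hom _ = _
  rw [map_smul, map_lineAug_lineClass, ← map_smul, smul_eq_mul, mul_one]

theorem augLineCoinvariants_exactAt_one
    (h : ∀ w w' : LineTuple F n 0, ∃ g : GL (Fin n) F, g • w = w') :
    (augLineCoinvariants k F n).ExactAt 1 := by
  let B := LinearMap.range (Representation.Coinvariants.map _ _ (lineD k F n 0).hom)
  by_cases hn : Nonempty (LineTuple F n 0)
  · obtain ⟨v⟩ := hn
    let s : Representation.Coinvariants (Representation.trivial k (GL (Fin n) F) k) →ₗ[k]
        Representation.Coinvariants (lineRep k F n 0).ρ ⧸ B :=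
      Representation.Coinvariants.lift _ (LinearMap.toSpanSingleton k _ (B.mkQ (lineClass k v)))
        (fun g => by ext; simp)
    refine exactAt_succ_of_factor _ 0 s B.mkQ (fun z => ?_) (fun z hz => ?_)
    · change (s ∘ₗ Representation.Coinvariants.map _ _ (lineAug k F n).hom) z = _
      refine LinearMap.congr_fun (coinvariants_hom_ext k fun w => ?_) z
      obtain ⟨g, rfl⟩ := h v w
      rw [LinearMap.comp_apply, map_lineAug_lineClass, lineClass_smul]
      simp [s]
    · rw [augLineCoinvariants_d_hom]
      exact (Submodule.Quotient.mk_eq_zero _).1 hz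
  · refine exactAt_succ_of_factor _ 0 0 B.mkQ (fun z => ?_) (fun z hz => ?_)
    · rw [LinearMap.zero_apply]
      exact LinearMap.congr_fun (coinvariants_hom_ext k (f := 0) fun w => (hn ⟨w⟩).elim) z
    · rw [augLineCoinvariants_d_hom]
      exact (Submodule.Quotient.mk_eq_zero _).1 hz

end

/-! ### Generic cones -/

section

variable {F : Type u} [Field F]

/-- Two families of vectors with the same linear relations differ by an element of `GL_n(F)`. -/
theorem exists_GL_mulVec_eq {ι : Type*} [Fintype ι] {n : ℕ} (W W' : ι → Fin n → F)
    (h : ∀ c : ι → F, ∑ j, c j • W j = 0 ↔ ∑ j, c j • W' j = 0) :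
    ∃ g : GL (Fin n) F, ∀ j, g.1.mulVec (W j) = W' j := by
  classical
  let T := Fintype.linearCombination F W
  let T' := Fintype.linearCombination F W'
  have hker : LinearMap.ker T = LinearMap.ker T' := by
    ext c
    simpa [T, T', Fintype.linearCombination_apply] using h c
  let e : LinearMap.range T ≃ₗ[F] LinearMap.range T' :=
    T.quotKerEquivRange.symm ≪≫ₗ Submodule.quotEquivOfEq _ _ hker ≪≫ₗ T'.quotKerEquivRange
  have he : ∀ c, (e ⟨T c, LinearMap.mem_range_self T c⟩ : Fin n → F) = T' c := by
    intro c
    have : T.quotKerEquivRange.symm ⟨T c, LinearMap.mem_range_self T c⟩ =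
        Submodule.Quotient.mk c := by
      rw [LinearEquiv.symm_apply_eq]
      rfl
    simp only [e, LinearEquiv.trans_apply, this]
    rfl
  obtain ⟨C, hC⟩ := Submodule.exists_isCompl (LinearMap.range T)
  obtain ⟨C', hC'⟩ := Submodule.exists_isCompl (LinearMap.range T')
  have hfin : Module.finrank F C = Module.finrank F C' := by
    have h1 := Submodule.finrank_add_eq_of_isCompl hC
    have h2 := Submodule.finrank_add_eq_of_isCompl hC'
    have h3 := e.finrank_eq
    omega
  let φ : (Fin n → F) ≃ₗ[F] (Fin n → F) :=
    (Submodule.prodEquivOfIsCompl _ _ hC).symm ≪≫ₗ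
      (e.prodCongr (LinearEquiv.ofFinrankEq C C' hfin)) ≪≫ₗ Submodule.prodEquivOfIsCompl _ _ hC'
  have hφ : ∀ c, φ (T c) = T' c := by
    intro c
    have := Submodule.prodEquivOfIsCompl_symm_apply_left _ _ hC
      (⟨T c, LinearMap.mem_range_self T c⟩ : LinearMap.range T)
    simp only [φ, LinearEquiv.trans_apply]
    rw [this]
    simp [he]
  refine ⟨Matrix.GeneralLinearGroup.toLin.symm
    (LinearMap.GeneralLinearGroup.ofLinearEquiv φ), fun j => ?_⟩
  have h1 : T (Pi.single j 1) = W j := by simp [T]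
  have h2 : T' (Pi.single j 1) = W' j := by simp [T']
  rw [← h1, ← h2, ← hφ]
  have : Matrix.GeneralLinearGroup.toLin (Matrix.GeneralLinearGroup.toLin.symm
    (LinearMap.GeneralLinearGroup.ofLinearEquiv φ)) =
    LinearMap.GeneralLinearGroup.ofLinearEquiv φ := MulEquiv.apply_symm_apply _ _
  have h4 := congrArg (fun f : LinearMap.GeneralLinearGroup F (Fin n → F) =>
    (f : (Fin n → F) →ₗ[F] (Fin n → F)) (T (Pi.single j 1))) this
  exact h4

namespace LineTuple

variable {n l : ℕ}

/-- The vectors `W j` span the lines of the tuple `w`. -/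
def IsSpannedBy (w : LineTuple F n l) (W : Fin (l + 1) → Fin n → F) : Prop :=
  ∀ j, ∃ h : W j ≠ 0, w.1 j = Projectivization.mk F (W j) h

theorem isSpannedBy_rep (w : LineTuple F n l) : w.IsSpannedBy fun j => (w.1 j).rep :=
  fun j => ⟨(w.1 j).rep_nonzero, (w.1 j).mk_rep.symm⟩

theorem IsSpannedBy.smul {w : LineTuple F n l} {W : Fin (l + 1) → Fin n → F}
    (h : w.IsSpannedBy W) (g : GL (Fin n) F) :
    (g • w).IsSpannedBy fun j => g.1.mulVec (W j) := by
  intro j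
  obtain ⟨h0, h1⟩ := h j
  have h2 : g • w.1 j = Projectivization.mk F (g • W j) ((smul_ne_zero_iff_ne g).2 h0) := by
    rw [h1, Projectivization.smul_mk]
  exact ⟨(smul_ne_zero_iff_ne g).2 h0, h2⟩

theorem IsSpannedBy.face {w : LineTuple F n (l + 1)} {W : Fin (l + 2) → Fin n → F}
    (h : w.IsSpannedBy W) (i : Fin (l + 2)) :
    (w.face i).IsSpannedBy fun j => W (i.succAbove j) :=
  fun j => h (i.succAbove j)

theorem IsSpannedBy.rescale {w : LineTuple F n l} {W : Fin (l + 1) → Fin n → F}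
    (h : w.IsSpannedBy W) {a : Fin (l + 1) → F} (ha : ∀ j, a j ≠ 0) :
    w.IsSpannedBy fun j => a j • W j := by
  intro j
  obtain ⟨h0, h1⟩ := h j
  refine ⟨smul_ne_zero (ha j) h0, h1.trans ?_⟩
  rw [Projectivization.mk_eq_mk_iff']
  exact ⟨(a j)⁻¹, by rw [smul_smul, inv_mul_cancel₀ (ha j), one_smul]⟩

theorem IsSpannedBy.exists_rescale {w : LineTuple F n l} {W W' : Fin (l + 1) → Fin n → F}
    (h : w.IsSpannedBy W) (h' : w.IsSpannedBy W') :
    ∃ a : Fin (l + 1) → F, (∀ j, a j ≠ 0) ∧ ∀ j, W j = a j • W' j := by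
  have : ∀ j, ∃ a : F, a ≠ 0 ∧ W j = a • W' j := by
    intro j
    obtain ⟨h0, h1⟩ := h j
    obtain ⟨h0', h1'⟩ := h' j
    obtain ⟨a, ha⟩ := (Projectivization.mk_eq_mk_iff' F _ _ h0 h0').1 (h1.symm.trans h1')
    refine ⟨a, ?_, ha.symm⟩
    rintro rfl
    exact h0 (by rw [← ha, zero_smul])
  choose a h1 h2 using this
  exact ⟨a, h1, h2⟩

theorem IsSpannedBy.unique {w w' : LineTuple F n l} {W : Fin (l + 1) → Fin n → F}
    (h : w.IsSpannedBy W) (h' : w'.IsSpannedBy W) : w = w' :=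
  Subtype.ext (funext fun j => (h j).choose_spec.trans (h' j).choose_spec.symm)

theorem IsSpannedBy.smul_ne {w : LineTuple F n l} {W : Fin (l + 1) → Fin n → F}
    (h : w.IsSpannedBy W) {i j : Fin (l + 1)} (hij : i ≠ j) (a : F) : a • W j ≠ W i := by
  intro ha
  obtain ⟨h0, h1⟩ := h i
  obtain ⟨h0', h1'⟩ := h j
  refine hij ((pairwiseGeneral_iff_injective _).1 w.2 ?_)
  rw [h1, h1', Projectivization.mk_eq_mk_iff']
  exact ⟨a, ha⟩

theorem exists_isSpannedBy {W : Fin (l + 1) → Fin n → F} (h0 : ∀ j, W j ≠ 0)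
    (h : ∀ i j, i ≠ j → ∀ a : F, a • W j ≠ W i) : ∃ w : LineTuple F n l, w.IsSpannedBy W := by
  refine ⟨⟨fun j => Projectivization.mk F (W j) (h0 j),
    (pairwiseGeneral_iff_injective _).2 fun i j hij => ?_⟩, fun j => ⟨h0 j, rfl⟩⟩
  by_contra hne
  obtain ⟨a, ha⟩ := (Projectivization.mk_eq_mk_iff' F _ _ _ _).1 hij
  exact h i j hne a ha

/-- Tuples of lines spanned by vectors with the same linear relations lie in one orbit. -/
theorem IsSpannedBy.exists_smul_eq {w w' : LineTuple F n l} {W W' : Fin (l + 1) → Fin n → F}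
    (h : w.IsSpannedBy W) (h' : w'.IsSpannedBy W')
    (hW : ∀ c : Fin (l + 1) → F, ∑ j, c j • W j = 0 ↔ ∑ j, c j • W' j = 0) :
    ∃ g : GL (Fin n) F, g • w = w' := by
  obtain ⟨g, hg⟩ := exists_GL_mulVec_eq W W' hW
  refine ⟨g, (h.smul g).unique ?_⟩
  simpa only [hg] using h'

end LineTuple

/-- The vector `v` is in general position with respect to the family `W`: it avoids every proper
subspace spanned by members of `W`. -/
def IsGenericVector {m n : ℕ} (W : Fin m → Fin n → F) (v : Fin n → F) : Prop :=
  ∀ J : Set (Fin m), Submodule.span F (W '' J) ≠ ⊤ → v ∉ Submodule.span F (W '' J)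

theorem exists_isGenericVector [Infinite F] {m n : ℕ} (W : Fin m → Fin n → F) :
    ∃ v, IsGenericVector W v := by
  classical
  let S : Finset (Subspace F (Fin n → F)) :=
    (Finset.univ.image fun J : Set (Fin m) => Submodule.span F (W '' J)).filter (· ≠ ⊤)
  have hS : ⊤ ∉ S := by simp [S]
  obtain ⟨v, hv⟩ := (Set.ne_univ_iff_exists_notMem _).1 (Subspace.biUnion_ne_univ_of_top_notMem hS)
  refine ⟨v, fun J hJ hvJ => hv ?_⟩
  simp only [Set.mem_iUnion]
  exact ⟨_, Finset.mem_filter.2 ⟨Finset.mem_image_of_mem _ (Finset.mem_univ J), hJ⟩, hvJ⟩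

namespace IsGenericVector

variable {m n : ℕ} {W : Fin m → Fin n → F} {v : Fin n → F}

theorem comp (h : IsGenericVector W v) {k : ℕ} (e : Fin k → Fin m) :
    IsGenericVector (fun j => W (e j)) v := by
  intro J hJ
  have : (fun j => W (e j)) '' J = W '' (e '' J) := by rw [Set.image_image]
  rw [this] at hJ ⊢
  exact h _ hJ

theorem map (h : IsGenericVector W v) (g : GL (Fin n) F) :
    IsGenericVector (fun j => g.1.mulVec (W j)) (g.1.mulVec v) := by
  intro J hJ hv
  let e : (Fin n → F) ≃ₗ[F] (Fin n → F) := Matrix.GeneralLinearGroup.toLin g |>.toLinearEquiv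
  have he : ∀ x, e x = g.1.mulVec x := fun x => rfl
  have himg : (fun j => g.1.mulVec (W j)) '' J = e '' (W '' J) := by
    rw [Set.image_image]
    rfl
  rw [himg, ← he] at hv
  rw [himg] at hJ
  have hs : Submodule.span F (e '' (W '' J)) =
      (Submodule.span F (W '' J)).map (e : (Fin n → F) →ₗ[F] (Fin n → F)) :=
    (Submodule.map_span (e : (Fin n → F) →ₗ[F] (Fin n → F)) (W '' J)).symm
  rw [hs] at hv hJ
  refine h J (fun htop => hJ ?_) ?_
  · rw [htop, Submodule.map_top, LinearEquiv.range]
  · obtain ⟨y, hy, hye⟩ := hv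
    rwa [← e.injective hye]

theorem rescale (h : IsGenericVector W v) {a : Fin m → F} (ha : ∀ j, a j ≠ 0) :
    IsGenericVector (fun j => a j • W j) v := by
  intro J
  have : Submodule.span F ((fun j => a j • W j) '' J) = Submodule.span F (W '' J) := by
    apply le_antisymm
    · rw [Submodule.span_le]
      rintro _ ⟨j, hj, rfl⟩
      exact Submodule.smul_mem _ _ (Submodule.subset_span ⟨j, hj, rfl⟩)
    · rw [Submodule.span_le]
      rintro _ ⟨j, hj, rfl⟩
      have := Submodule.smul_mem (Submodule.span F ((fun j => a j • W j) '' J)) (a j)⁻¹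
        (Submodule.subset_span ⟨j, hj, rfl⟩)
      simpa [smul_smul, inv_mul_cancel₀ (ha j)] using this
  rw [this]
  exact h J

theorem ne_zero (h : IsGenericVector W v) (hn : 0 < n) : v ≠ 0 := by
  rintro rfl
  have : Nonempty (Fin n) := ⟨⟨0, hn⟩⟩
  exact h ∅ (by simp) (Submodule.zero_mem _)

theorem smul_ne (h : IsGenericVector W v) (hn : 1 < n) (j : Fin m) (a : F) : a • W j ≠ v := by
  rintro rfl
  refine h {j} (fun htop => ?_) ?_
  · have h1 := finrank_span_le_card (R := F) ({W j} : Set (Fin n → F))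
    rw [Set.image_singleton] at htop
    rw [htop, finrank_top] at h1
    simp at h1
    omega
  · exact Submodule.smul_mem _ _ (Submodule.subset_span ⟨j, rfl, rfl⟩)

end IsGenericVector

namespace LineTuple

variable {n l : ℕ}

/-- The tuple `t` is obtained from `w` by adding in front a line in general position. -/
def IsGenericCone (w : LineTuple F n l) (t : LineTuple F n (l + 1)) : Prop :=
  ∃ (W : Fin (l + 1) → Fin n → F) (v : Fin n → F), w.IsSpannedBy W ∧ IsGenericVector W v ∧
    t.IsSpannedBy (Fin.cons v W)

theorem IsGenericCone.smul {w : LineTuple F n l} {t : LineTuple F n (l + 1)}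
    (h : w.IsGenericCone t) (g : GL (Fin n) F) : (g • w).IsGenericCone (g • t) := by
  obtain ⟨W, v, hW, hv, ht⟩ := h
  refine ⟨_, _, hW.smul g, hv.map g, ?_⟩
  have := ht.smul g
  convert this using 2 with j
  refine Fin.cases ?_ (fun i => ?_) j <;> simp

/-- Any tuple can be completed by a line in general position, which is then in general position
with respect to all faces. -/
theorem exists_genericCone_faces [Infinite F] (hn : 1 < n) (w : LineTuple F n (l + 1)) :
    ∃ t : LineTuple F n (l + 2), t.face 0 = w ∧
      ∀ i, (w.face i).IsGenericCone (t.face i.succ) := by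
  have hw := w.isSpannedBy_rep
  obtain ⟨v, hv⟩ := exists_isGenericVector fun j => (w.1 j).rep
  have hv0 := hv.ne_zero (by omega)
  obtain ⟨t, ht⟩ := exists_isSpannedBy (W := Fin.cons v fun j => (w.1 j).rep) (by
    refine Fin.cases ?_ fun j => ?_
    · simpa using hv0
    · simpa using (w.1 j).rep_nonzero) (by
    refine Fin.cases (Fin.cases ?_ fun j => ?_) fun i => Fin.cases ?_ fun j => ?_
    · simp
    · intro _ a
      simpa using hv.smul_ne hn j a
    · intro _ a ha
      simp only [Fin.cons_zero, Fin.cons_succ] at ha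
      have ha0 : a ≠ 0 := by
        rintro rfl
        exact (w.1 i).rep_nonzero (by rw [← ha, zero_smul])
      exact hv.smul_ne hn i a⁻¹ (by rw [← ha, smul_smul, inv_mul_cancel₀ ha0, one_smul])
    · intro hij a
      simpa using hw.smul_ne (fun h => hij (congrArg _ h)) a)
  refine ⟨t, (ht.face 0).unique hw, fun i => ⟨_, v, hw.face i, hv.comp _, ?_⟩⟩
  convert ht.face i.succ using 2 with j
  refine Fin.cases ?_ (fun j => ?_) j <;> simp

end LineTuple

/-- If a cocycle `c` takes the same value on all generic cones over `w`, that value, as a function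
of `w`, has coboundary `c`: apply the cocycle relation to a generic cone. -/
theorem cocyclesAreCoboundaries_of_genericCone [Infinite F] {n l : ℕ} (hn : 1 < n)
    (h : ∀ (A : Type u) [AddCommGroup A] (c : LineTuple F n (l + 1) → A), IsLineCocycle c →
      ∀ w t t', LineTuple.IsGenericCone w t → LineTuple.IsGenericCone w t' → c t = c t') :
    CocyclesAreCoboundaries F n l := by
  intro A _ c hc
  classical
  let s : LineTuple F n l → A := fun w =>
    if h : ∃ t, LineTuple.IsGenericCone w t then c h.choose else 0
  have hs : ∀ w t, LineTuple.IsGenericCone w t → s w = c t := by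
    intro w t ht
    have hex : ∃ t, LineTuple.IsGenericCone w t := ⟨t, ht⟩
    simp only [s, dif_pos hex]
    exact h A c hc w _ _ hex.choose_spec ht
  refine ⟨s, fun g w => ?_, fun w => ?_⟩
  · by_cases hex : ∃ t, LineTuple.IsGenericCone w t
    · obtain ⟨t, ht⟩ := hex
      rw [hs w t ht, hs _ _ (ht.smul g), hc.smul]
    · have hex' : ¬ ∃ t, LineTuple.IsGenericCone (g • w) t := by
        rintro ⟨t, ht⟩
        refine hex ⟨g⁻¹ • t, ?_⟩
        simpa using ht.smul g⁻¹
      simp only [s, dif_neg hex, dif_neg hex']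
  · obtain ⟨t, ht0, ht⟩ := LineTuple.exists_genericCone_faces hn w
    have hb := hc.boundary t
    rw [Fin.sum_univ_succ, ht0] at hb
    simp only [Fin.val_zero, pow_zero, one_smul, Fin.val_succ] at hb
    rw [eq_neg_of_add_eq_zero_left hb, ← Finset.sum_neg_distrib]
    refine Finset.sum_congr rfl fun i _ => ?_
    rw [hs _ _ (ht i), pow_succ, mul_neg_one, neg_smul, neg_neg]

end

/-! ### Gale duality -/

section

variable {F : Type u} [Field F] {n l : ℕ}
  {V V' : Type*} [AddCommGroup V] [Module F V] [AddCommGroup V'] [Module F V']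

/-- `x` is a Gale dual of `W`: the linear relations among the vectors `W j` are exactly the families
`f (x j)`, for `f` a linear functional. -/
def IsGaleDual {ι : Type*} [Fintype ι] (x : ι → V) (W : ι → Fin n → F) : Prop :=
  ∀ c : ι → F, ∑ j, c j • W j = 0 ↔ ∃ f : Module.Dual F V, ∀ j, c j = f (x j)

/-- A functional that vanishes on all but two of the vectors `x j` is zero. In terms of Gale duals,
this says that any two of the dual vectors are linearly independent. -/
def IsCosimple {ι : Type*} (x : ι → V) : Prop :=
  ∀ f : Module.Dual F V, (∃ i j, ∀ k, k ≠ i → k ≠ j → f (x k) = 0) → f = 0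

namespace LineTuple

/-- `x` is a Gale dual of vectors spanning the lines of `w`. -/
def HasGaleDual (w : LineTuple F n l) (x : Fin (l + 1) → V) : Prop :=
  ∃ W, w.IsSpannedBy W ∧ IsGaleDual x W

theorem HasGaleDual.exists_smul_eq {w w' : LineTuple F n l} {x : Fin (l + 1) → V}
    (h : w.HasGaleDual x) (h' : w'.HasGaleDual x) : ∃ g : GL (Fin n) F, g • w = w' := by
  obtain ⟨W, hW, hx⟩ := h
  obtain ⟨W', hW', hx'⟩ := h'
  exact hW.exists_smul_eq hW' fun c => (hx c).trans (hx' c).symm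

theorem HasGaleDual.congr {w : LineTuple F n l} {x : Fin (l + 1) → V} {x' : Fin (l + 1) → V'}
    (h : w.HasGaleDual x) (φ : V ≃ₗ[F] V') (a : Fin (l + 1) → F) (ha : ∀ j, a j ≠ 0)
    (hx' : ∀ j, φ (x j) = a j • x' j) : w.HasGaleDual x' := by
  obtain ⟨W, hW, hx⟩ := h
  refine ⟨_, hW.rescale ha, fun c => ?_⟩
  have : ∑ j, c j • a j • W j = ∑ j, (c j * a j) • W j := by simp only [smul_smul]
  rw [this, hx fun j => c j * a j]
  constructor
  · rintro ⟨f, hf⟩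
    refine ⟨f ∘ₗ φ.symm.toLinearMap, fun j => ?_⟩
    have h1 : x j = a j • φ.symm (x' j) := by
      rw [← map_smul, ← hx', LinearEquiv.symm_apply_apply]
    have h2 := hf j
    rw [h1, map_smul, smul_eq_mul, mul_comm] at h2
    exact mul_left_cancel₀ (ha j) h2
  · rintro ⟨f, hf⟩
    refine ⟨f ∘ₗ φ.toLinearMap, fun j => ?_⟩
    rw [LinearMap.comp_apply, LinearEquiv.coe_coe, hx', map_smul, hf, smul_eq_mul, mul_comm]

end LineTuple

/-- The linear map `π` is a projection from the point spanned by `v`. -/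
structure IsProjectionFrom (π : V →ₗ[F] V') (v : V) : Prop where
  surjective : Function.Surjective π
  apply_eq_zero_iff : ∀ w, π w = 0 ↔ ∃ a : F, w = a • v

theorem IsProjectionFrom.exists_factor {π : V →ₗ[F] V'} {v : V} (h : IsProjectionFrom π v)
    (f : Module.Dual F V) (hf : f v = 0) : ∃ f' : Module.Dual F V', f = f' ∘ₗ π := by
  obtain ⟨σ, hσ⟩ := π.exists_rightInverse_of_surjective (LinearMap.range_eq_top.2 h.surjective)
  refine ⟨f ∘ₗ σ, LinearMap.ext fun w => ?_⟩
  have h1 : π (w - σ (π w)) = 0 := by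
    rw [map_sub, ← LinearMap.comp_apply π σ, hσ, LinearMap.id_apply, sub_self]
  obtain ⟨a, ha⟩ := (h.apply_eq_zero_iff _).1 h1
  have h2 : f (w - σ (π w)) = 0 := by rw [ha, map_smul, hf, smul_zero]
  rw [map_sub, sub_eq_zero] at h2
  exact h2

/-- Omitting a line corresponds to projecting the Gale dual from the corresponding point. -/
theorem LineTuple.HasGaleDual.face {w : LineTuple F n (l + 1)} {u : Fin (l + 2) → V}
    (h : w.HasGaleDual u) {i : Fin (l + 2)} {π : V →ₗ[F] V'} (hπ : IsProjectionFrom π (u i)) :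
    (w.face i).HasGaleDual fun j => π (u (i.succAbove j)) := by
  obtain ⟨W, hW, hu⟩ := h
  refine ⟨_, hW.face i, fun c => ?_⟩
  have key := hu (i.insertNth 0 c)
  rw [Fin.sum_univ_succAbove _ i] at key
  simp only [Fin.insertNth_apply_same, Fin.insertNth_apply_succAbove, zero_smul, zero_add] at key
  rw [key]
  constructor
  · rintro ⟨f, hf⟩
    have h0 := hf i
    rw [Fin.insertNth_apply_same] at h0
    obtain ⟨f', rfl⟩ := hπ.exists_factor f h0.symm
    refine ⟨f', fun j => ?_⟩
    simpa using hf (i.succAbove j)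
  · rintro ⟨f', hf⟩
    have h0 : π (u i) = 0 := (hπ.apply_eq_zero_iff _).2 ⟨1, (one_smul _ _).symm⟩
    refine ⟨f' ∘ₗ π, fun j => ?_⟩
    rcases Fin.eq_self_or_eq_succAbove i j with rfl | ⟨j, rfl⟩
    · simp [h0]
    · simpa using hf j

/-- A cosimple family has a Gale dual: the basis vectors of `F^(l+1)`, modulo the space of families
`f (x j)`. -/
theorem IsCosimple.exists_hasGaleDual [Module.Finite F V] {x : Fin (l + 1) → V}
    (hx : IsCosimple (F := F) x) (hn : Module.finrank F V + n = l + 1) :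
    ∃ w : LineTuple F n l, w.HasGaleDual x := by
  classical
  let T : Module.Dual F V →ₗ[F] (Fin (l + 1) → F) := LinearMap.pi fun j => Module.Dual.eval F V (x j)
  have hT : ∀ f j, T f j = f (x j) := fun f j => rfl
  have hinj : Function.Injective T := by
    rw [injective_iff_map_eq_zero]
    intro f hf
    exact hx f ⟨0, 0, fun k _ _ => by rw [← hT, hf]; rfl⟩
  have hfin : Module.finrank F ((Fin (l + 1) → F) ⧸ LinearMap.range T) = n := by
    have h1 := Submodule.finrank_quotient_add_finrank (LinearMap.range T)
    rw [LinearMap.finrank_range_of_inj hinj, Subspace.dual_finrank_eq, Module.finrank_fin_fun] at h1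
    omega
  let e : ((Fin (l + 1) → F) ⧸ LinearMap.range T) ≃ₗ[F] (Fin n → F) :=
    LinearEquiv.ofFinrankEq _ _ (by rw [hfin, Module.finrank_fin_fun])
  let W : Fin (l + 1) → Fin n → F := fun j => e (Submodule.Quotient.mk (Pi.single j 1))
  have hsum : ∀ c : Fin (l + 1) → F, ∑ j, c j • W j = e (Submodule.Quotient.mk c) := by
    intro c
    have : ∑ j, c j • W j = (e.toLinearMap ∘ₗ (LinearMap.range T).mkQ)
        (∑ j, c j • Pi.single j 1) := by
      simp [W]
    rw [this]
    have hc : ∑ j, c j • (Pi.single j 1 : Fin (l + 1) → F) = c := by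
      ext k
      simp [Finset.sum_apply, Pi.single_apply]
    rw [hc]
    rfl
  have hgale : IsGaleDual x W := by
    intro c
    rw [hsum, LinearEquiv.map_eq_zero_iff, Submodule.Quotient.mk_eq_zero]
    constructor
    · rintro ⟨f, rfl⟩
      exact ⟨f, fun j => rfl⟩
    · rintro ⟨f, hf⟩
      exact ⟨f, funext fun j => (hf j).symm⟩
  -- A relation supported on two indices comes from the zero functional.
  have hrel : ∀ c : Fin (l + 1) → F, ∑ j, c j • W j = 0 →
      (∃ i j, ∀ k, k ≠ i → k ≠ j → c k = 0) → c = 0 := by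
    rintro c hc ⟨i, j, hij⟩
    obtain ⟨f, hf⟩ := (hgale c).1 hc
    have : f = 0 := hx f ⟨i, j, fun k hi hj => by rw [← hf, hij k hi hj]⟩
    ext k
    rw [hf, this]
    rfl
  obtain ⟨w, hw⟩ := LineTuple.exists_isSpannedBy (W := W) (fun j hj => by
      have := congrFun (hrel (Pi.single j 1) (by
        rw [Finset.sum_eq_single j] <;> simp +contextual [hj]) ⟨j, j, fun k hk _ => by simp [hk]⟩) j
      simp at this) (fun i j hij a ha => by
      have := congrFun (hrel (Pi.single j a - Pi.single i 1) (by
        simp only [Pi.sub_apply, sub_smul, Finset.sum_sub_distrib]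
        rw [Finset.sum_eq_single j, Finset.sum_eq_single i] <;> simp +contextual [ha])
        ⟨i, j, fun k hi hj => by simp [hi, hj]⟩) i
      simp [hij] at this)
  exact ⟨w, W, hw, hgale⟩

section GaleValue

variable {A : Type*} [AddCommGroup A]

open Classical in
/-- The value of a function on tuples of lines at a tuple with the given Gale dual (and zero if
there is none). -/
noncomputable def galeValue (c : LineTuple F n l → A) (x : Fin (l + 1) → V) : A :=
  if h : ∃ w : LineTuple F n l, w.HasGaleDual x then c h.choose else 0

theorem LineTuple.HasGaleDual.galeValue_eq {c : LineTuple F n l → A}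
    (hc : ∀ (g : GL (Fin n) F) w, c (g • w) = c w) {w : LineTuple F n l} {x : Fin (l + 1) → V}
    (h : w.HasGaleDual x) : galeValue c x = c w := by
  have hex : ∃ w : LineTuple F n l, w.HasGaleDual x := ⟨w, h⟩
  rw [galeValue, dif_pos hex]
  obtain ⟨g, hg⟩ := h.exists_smul_eq hex.choose_spec
  rw [← hg, hc]

theorem galeValue_congr (c : LineTuple F n l → A) {x : Fin (l + 1) → V} {x' : Fin (l + 1) → V'}
    (φ : V ≃ₗ[F] V') (a : Fin (l + 1) → F) (ha : ∀ j, a j ≠ 0)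
    (hx' : ∀ j, φ (x j) = a j • x' j) : galeValue c x = galeValue c x' := by
  have : (fun w : LineTuple F n l => w.HasGaleDual x) = fun w => w.HasGaleDual x' := by
    ext w
    refine ⟨fun h => h.congr φ a ha hx', fun h => h.congr φ.symm (fun j => (a j)⁻¹)
      (fun j => inv_ne_zero (ha j)) fun j => ?_⟩
    rw [LinearEquiv.symm_apply_eq, map_smul, hx', smul_smul, inv_mul_cancel₀ (ha j), one_smul]
  have hcongr : ∀ P Q : LineTuple F n l → Prop, P = Q →
      (open Classical in (if h : ∃ w, P w then c h.choose else 0)) =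
        (open Classical in (if h : ∃ w, Q w then c h.choose else 0)) := by
    rintro P _ rfl
    rfl
  exact hcongr _ _ this

theorem galeValue_rescale (c : LineTuple F n l → A) {x x' : Fin (l + 1) → V}
    (a : Fin (l + 1) → F) (ha : ∀ j, a j ≠ 0) (hx' : ∀ j, x j = a j • x' j) :
    galeValue c x = galeValue c x' :=
  galeValue_congr c (LinearEquiv.refl F V) a ha hx'

/-- The family `x` arises, up to rescaling, by projecting the family `u` from its `i`-th member. -/
def IsProjectedFamily (u : Fin (l + 2) → V) (i : Fin (l + 2)) (x : Fin (l + 1) → V') : Prop :=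
  ∃ π : V →ₗ[F] V', IsProjectionFrom π (u i) ∧
    ∀ j, ∃ a : F, a ≠ 0 ∧ π (u (i.succAbove j)) = a • x j

/-- The cocycle relation in terms of Gale duals: the alternating sum over the projections of a
configuration from its members vanishes. The configuration is cosimple since a functional vanishing
on one of its members factors through the projection from that member. -/
theorem IsLineCocycle.sum_galeValue_eq_zero [Module.Finite F V] {c : LineTuple F n (l + 1) → A}
    (hc : IsLineCocycle c) (hn : Module.finrank F V + n = l + 3)
    (u : Fin (l + 3) → V) (x : Fin (l + 3) → Fin (l + 2) → V')
    (hx : ∀ i, IsProjectedFamily (F := F) u i (x i)) (hgood : ∀ i, IsCosimple (F := F) (x i)) :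
    ∑ i : Fin (l + 3), (-1 : ℤ) ^ (i : ℕ) • galeValue c (x i) = 0 := by
  have hu : IsCosimple (F := F) u := by
    rintro f ⟨i, j, hij⟩
    obtain ⟨k, hki, hkj⟩ : ∃ k : Fin (l + 3), k ≠ i ∧ k ≠ j := by
      obtain ⟨k, hk⟩ := Finset.exists_mem_notMem_of_card_lt_card (s := {i, j})
        (t := (Finset.univ : Finset (Fin (l + 3)))) (by
          refine lt_of_le_of_lt Finset.card_le_two ?_
          simp)
      exact ⟨k, by simpa using hk.2⟩
    obtain ⟨π, hπ, hπx⟩ := hx k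
    obtain ⟨f', rfl⟩ := hπ.exists_factor f (hij k hki hkj)
    obtain ⟨i, rfl⟩ := Fin.exists_succAbove_eq hki.symm
    obtain ⟨j, rfl⟩ := Fin.exists_succAbove_eq hkj.symm
    rw [hgood k f' ⟨i, j, fun m hmi hmj => ?_⟩, LinearMap.zero_comp]
    obtain ⟨a, ha, hm⟩ := hπx m
    have h1 := hij (k.succAbove m) (by simpa using hmi) (by simpa using hmj)
    rw [LinearMap.comp_apply, hm, map_smul, smul_eq_zero] at h1
    exact h1.resolve_left ha
  obtain ⟨w, hw⟩ := hu.exists_hasGaleDual (n := n) (l := l + 2) (by omega)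
  rw [← hc.boundary w]
  refine Finset.sum_congr rfl fun i _ => ?_
  obtain ⟨π, hπ, hπx⟩ := hx i
  choose a ha hax using hπx
  rw [← (hw.face hπ).galeValue_eq hc.smul, galeValue_rescale c a ha hax]

end GaleValue

end

/-! ### Configurations on two lines -/

section

variable {F : Type u} [Field F]

/-- The determinant of two vectors of the plane. -/
def det₂ (p q : F × F) : F := p.1 * q.2 - p.2 * q.1

/-- The projection of `F³` from the point `(1, a, b)`. -/
def projAffine (a b : F) : F × F × F →ₗ[F] F × F where
  toFun v := (v.2.1 - a * v.1, v.2.2 - b * v.1)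
  map_add' v w := by ext <;> (simp; ring)
  map_smul' r v := by ext <;> (simp; ring)

/-- The projection of `F³` from the point `(0, 1, s)`. -/
def projInfinity (s : F) : F × F × F →ₗ[F] F × F where
  toFun v := (v.1, v.2.2 - s * v.2.1)
  map_add' v w := by ext <;> simp <;> ring
  map_smul' r v := by ext <;> simp <;> ring

theorem isProjectionFrom_projAffine (a b : F) :
    IsProjectionFrom (projAffine a b) ((1, a, b) : F × F × F) where
  surjective w := ⟨(0, w.1, w.2), by simp [projAffine]⟩
  apply_eq_zero_iff w := by
    constructor
    · intro h
      simp only [projAffine, LinearMap.coe_mk, AddHom.coe_mk, Prod.mk_eq_zero, sub_eq_zero] at h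
      refine ⟨w.1, Prod.ext (by simp) (Prod.ext ?_ ?_)⟩
      · simp [h.1, mul_comm]
      · simp [h.2, mul_comm]
    · rintro ⟨r, rfl⟩
      simp [projAffine, mul_comm]

theorem isProjectionFrom_projInfinity (s : F) :
    IsProjectionFrom (projInfinity s) ((0, 1, s) : F × F × F) where
  surjective w := ⟨(w.1, 0, w.2), by simp [projInfinity]⟩
  apply_eq_zero_iff w := by
    constructor
    · intro h
      simp only [projInfinity, LinearMap.coe_mk, AddHom.coe_mk, Prod.mk_eq_zero, sub_eq_zero] at h
      refine ⟨w.2.1, Prod.ext (by simp [h.1]) (Prod.ext (by simp) ?_)⟩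
      simp [h.2, mul_comm]
    · rintro ⟨r, rfl⟩
      simp [projInfinity, mul_comm]

/-- Six vectors of the plane form a cosimple family if three of them do not lie on the line of
vectors with first coordinate zero, and only vectors on that line may be proportional. -/
theorem isCosimple_of_det {x : Fin 6 → F × F}
    (hdet : ∀ j k, j ≠ k → (x j).1 ≠ 0 → det₂ (x j) (x k) ≠ 0)
    (e : Fin 3 → Fin 6) (he : Function.Injective e) (hx : ∀ t, (x (e t)).1 ≠ 0) :
    IsCosimple (F := F) x := by
  rintro f ⟨i, j, hij⟩
  obtain ⟨k, hki, hkj, hk⟩ : ∃ k, k ≠ i ∧ k ≠ j ∧ (x k).1 ≠ 0 := by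
    obtain ⟨k, hk, hk'⟩ := Finset.exists_mem_notMem_of_card_lt_card (s := {i, j})
      (t := Finset.univ.image e) (lt_of_le_of_lt Finset.card_le_two
        (by rw [Finset.card_image_of_injective _ he]; simp))
    obtain ⟨t, -, rfl⟩ := Finset.mem_image.1 hk
    have hk' : e t ≠ i ∧ e t ≠ j := by simpa using hk'
    exact ⟨e t, hk'.1, hk'.2, hx t⟩
  obtain ⟨m, hm⟩ := Finset.exists_mem_notMem_of_card_lt_card (s := {i, j, k})
    (t := (Finset.univ : Finset (Fin 6))) (lt_of_le_of_lt Finset.card_le_three (by simp))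
  have hm : m ≠ i ∧ m ≠ j ∧ m ≠ k := by simpa using hm.2
  have h1 := hij k hki hkj
  have h2 := hij m hm.1 hm.2.1
  have hd := hdet k m hm.2.2.symm hk
  have hf : ∀ p : F × F, f p = p.1 * f (1, 0) + p.2 * f (0, 1) := by
    intro p
    have : p = p.1 • ((1, 0) : F × F) + p.2 • ((0, 1) : F × F) := by ext <;> simp
    conv_lhs => rw [this]
    simp only [map_add, map_smul, smul_eq_mul]
  rw [hf] at h1 h2
  have h3 : f (1, 0) = 0 := by
    refine (mul_eq_zero.1 (?_ : det₂ (x k) (x m) * f (1, 0) = 0)).resolve_left hd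
    simp only [det₂]
    linear_combination (x m).2 * h1 - (x k).2 * h2
  have h4 : f (0, 1) = 0 := by
    refine (mul_eq_zero.1 (?_ : det₂ (x k) (x m) * f (0, 1) = 0)).resolve_left hd
    simp only [det₂]
    linear_combination (x k).1 * h2 - (x m).1 * h1
  ext <;> simp [h3, h4]

theorem isCosimple_of_pairwise_det {x : Fin 6 → F × F}
    (hdet : ∀ j k, j ≠ k → det₂ (x j) (x k) ≠ 0) : IsCosimple (F := F) x := by
  have h : ∀ j k, j ≠ k → (x j).1 = 0 → (x k).1 ≠ 0 := fun j k hjk h h' =>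
    hdet j k hjk (by simp [det₂, h, h'])
  -- At most one of the first coordinates vanishes; choose three other indices.
  by_cases h0 : (x 0).1 = 0 ∨ (x 1).1 = 0 ∨ (x 2).1 = 0
  · refine isCosimple_of_det (fun j k h _ => hdet j k h) ![3, 4, 5] (by decide) fun t => ?_
    rcases h0 with h0 | h0 | h0 <;> refine h _ _ ?_ h0 <;> fin_cases t <;> decide
  · push Not at h0
    refine isCosimple_of_det (fun j k h _ => hdet j k h) ![0, 1, 2] (by decide) fun t => ?_
    fin_cases t <;> simp [h0]

theorem isProjectedFamily_affine {u : Fin 7 → F × F × F} {i : Fin 7} {x : Fin 6 → F × F} {a b : F}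
    (hu : u i = (1, a, b)) (r : Fin 6 → F) (hr : ∀ j, r j ≠ 0)
    (h : ∀ j, projAffine a b (u (i.succAbove j)) = r j • x j) : IsProjectedFamily (F := F) u i x :=
  ⟨_, hu ▸ isProjectionFrom_projAffine a b, fun j => ⟨r j, hr j, h j⟩⟩

theorem isProjectedFamily_infinity {u : Fin 7 → F × F × F} {i : Fin 7} {x : Fin 6 → F × F} {s : F}
    (hu : u i = (0, 1, s)) (r : Fin 6 → F) (hr : ∀ j, r j ≠ 0)
    (h : ∀ j, projInfinity s (u (i.succAbove j)) = r j • x j) : IsProjectedFamily (F := F) u i x :=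
  ⟨_, hu ▸ isProjectionFrom_projInfinity s, fun j => ⟨r j, hr j, h j⟩⟩

variable {A : Type*} [AddCommGroup A] {c : LineTuple F 4 5 → A}

theorem IsLineCocycle.sum_galeValue (hc : IsLineCocycle c)
    (u : Fin 7 → F × F × F) (x : Fin 7 → Fin 6 → F × F)
    (hx : ∀ i, IsProjectedFamily (F := F) u i (x i)) (hgood : ∀ i, IsCosimple (F := F) (x i)) :
    ∑ i : Fin 7, (-1 : ℤ) ^ (i : ℕ) • galeValue c (x i) = 0 :=
  hc.sum_galeValue_eq_zero (by simp) u x hx hgood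


/-- The relation given by seven points of the projective plane that lie on two lines, according to
whether their index is in `S`, and differ from the intersection of the two lines. Projection from a
point makes the other points on its line coincide, and leaves the points on the other line in
place. -/
theorem galeValue_two_lines (hc : IsLineCocycle c) (S : Fin 7 → Prop) [DecidablePred S]
    {b : Fin 7 → F} (hb : Function.Injective b)
    (hS : ∀ i, ∃ e : Fin 3 → Fin 6, Function.Injective e ∧
      ∀ t, (S i ↔ ¬ S (i.succAbove (e t)))) :
    ∑ i : Fin 7, (-1 : ℤ) ^ (i : ℕ) • galeValue c (fun j : Fin 6 =>
      if S i ↔ S (i.succAbove j) then ((0, 1) : F × F) else (1, b (i.succAbove j))) = 0 := by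
  have hb' : ∀ i j, j ≠ i → b j - b i ≠ 0 := fun i j h => sub_ne_zero.2 (hb.ne h)
  refine hc.sum_galeValue (fun j => if S j then (0, 1, b j) else (1, 0, b j)) _ (fun i => ?_)
    (fun i => ?_)
  · by_cases hi : S i
    · refine isProjectedFamily_infinity (s := b i) (by simp [hi])
        (fun j => if S (i.succAbove j) then b (i.succAbove j) - b i else 1) (fun j => ?_)
        (fun j => ?_)
      · split_ifs
        · exact hb' _ _ (Fin.succAbove_ne _ _)
        · exact one_ne_zero
      · by_cases hj : S (i.succAbove j) <;> simp [hi, hj, projInfinity]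
    · refine isProjectedFamily_affine (a := 0) (b := b i) (by simp [hi])
        (fun j => if S (i.succAbove j) then 1 else b (i.succAbove j) - b i) (fun j => ?_)
        (fun j => ?_)
      · split_ifs
        · exact one_ne_zero
        · exact hb' _ _ (Fin.succAbove_ne _ _)
      · by_cases hj : S (i.succAbove j) <;> simp [hi, hj, projAffine]
  · obtain ⟨e, he, het⟩ := hS i
    refine isCosimple_of_det (fun j k hjk => ?_) e he (fun t => ?_)
    · have := hb' (i.succAbove j) (i.succAbove k) (by simpa using hjk.symm)
      by_cases hj : S i ↔ S (i.succAbove j) <;> by_cases hk : S i ↔ S (i.succAbove k) <;>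
        simp [hj, hk, det₂, this]
    · have := het t
      rw [if_neg (by tauto)]
      simp

theorem exists_embedding_compl {F : Type*} [Infinite F] {s : Set F} (hs : s.Finite) (m : ℕ) :
    Nonempty (Fin m ↪ (sᶜ : Set F)) := by
  have : Infinite (sᶜ : Set F) := hs.infinite_compl.to_subtype
  exact ⟨Fin.valEmbedding.trans (Infinite.natEmbedding _)⟩

/-- A cocycle vanishes at four points of the line and a double point in the first two positions. For
three points on one line and four on another, the projections from the three points are all of
this shape, with alternating sum equal to one of them, and those from the other four cancel. -/
theorem galeValue_double_first [Infinite F] (hc : IsLineCocycle c) {s : Fin 4 → F}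
    (hs : Function.Injective s) :
    galeValue c (![(0, 1), (0, 1), (1, s 0), (1, s 1), (1, s 2), (1, s 3)] : Fin 6 → F × F) = 0 := by
  obtain ⟨e⟩ := exists_embedding_compl (Set.finite_range s) 3
  have hb : Function.Injective (Fin.append (fun i => (e i : F)) s) := by
    rw [Fin.append_injective_iff]
    exact ⟨Subtype.val_injective.comp e.injective, hs, fun i j h => (e i).2 ⟨j, h.symm⟩⟩
  have h := galeValue_two_lines hc (fun j => 3 ≤ j) hb (by
    intro i
    fin_cases i <;> first
      | exact ⟨![0, 1, 2], by decide, by decide⟩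
      | exact ⟨![3, 4, 5], by decide, by decide⟩)
  rw [Fin.sum_univ_seven] at h
  set b := Fin.append (fun i => (e i : F)) s
  have hx : ∀ i : Fin 7, ¬ 3 ≤ i → (fun j : Fin 6 => if 3 ≤ i ↔ 3 ≤ i.succAbove j then
      ((0, 1) : F × F) else (1, b (i.succAbove j))) =
        ![(0, 1), (0, 1), (1, s 0), (1, s 1), (1, s 2), (1, s 3)] := by
    intro i hi
    funext j
    fin_cases i <;> first | exact absurd (by decide) hi | (fin_cases j <;> rfl)
  have hy : ∀ i : Fin 7, 3 ≤ i → (fun j : Fin 6 => if 3 ≤ i ↔ 3 ≤ i.succAbove j then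
      ((0, 1) : F × F) else (1, b (i.succAbove j))) =
        ![(1, b 0), (1, b 1), (1, b 2), (0, 1), (0, 1), (0, 1)] := by
    intro i hi
    funext j
    fin_cases i <;> first | exact absurd hi (by decide) | (fin_cases j <;> rfl)
  rw [hx 0 (by decide), hx 1 (by decide), hx 2 (by decide), hy 3 (by decide), hy 4 (by decide),
    hy 5 (by decide), hy 6 (by decide)] at h
  rw [← h]
  norm_num [Fin.val_ofNat]

/-- A cocycle vanishes at four points of the line and a double point in the last two positions. -/
theorem galeValue_double_last [Infinite F] (hc : IsLineCocycle c) {s : Fin 4 → F}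
    (hs : Function.Injective s) :
    galeValue c (![(1, s 0), (1, s 1), (1, s 2), (1, s 3), (0, 1), (0, 1)] : Fin 6 → F × F) = 0 := by
  obtain ⟨e⟩ := exists_embedding_compl (Set.finite_range s) 3
  have hb : Function.Injective (Fin.append s (fun i => (e i : F))) := by
    rw [Fin.append_injective_iff]
    exact ⟨hs, Subtype.val_injective.comp e.injective, fun i j h => (e j).2 ⟨i, h⟩⟩
  have h := galeValue_two_lines hc (fun j => 3 < j) hb (by
    intro i
    fin_cases i <;> first
      | exact ⟨![0, 1, 2], by decide, by decide⟩
      | exact ⟨![3, 4, 5], by decide, by decide⟩)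
  rw [Fin.sum_univ_seven] at h
  set b := Fin.append s (fun i => (e i : F))
  have hx : ∀ i : Fin 7, 3 < i → (fun j : Fin 6 => if 3 < i ↔ 3 < i.succAbove j then
      ((0, 1) : F × F) else (1, b (i.succAbove j))) =
        ![(1, s 0), (1, s 1), (1, s 2), (1, s 3), (0, 1), (0, 1)] := by
    intro i hi
    funext j
    fin_cases i <;> first | exact absurd hi (by decide) | (fin_cases j <;> rfl)
  have hy : ∀ i : Fin 7, ¬ 3 < i → (fun j : Fin 6 => if 3 < i ↔ 3 < i.succAbove j then
      ((0, 1) : F × F) else (1, b (i.succAbove j))) =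
        ![(0, 1), (0, 1), (0, 1), (1, b 4), (1, b 5), (1, b 6)] := by
    intro i hi
    funext j
    fin_cases i <;> first | exact absurd (by decide) hi | (fin_cases j <;> rfl)
  rw [hy 0 (by decide), hy 1 (by decide), hy 2 (by decide), hy 3 (by decide), hx 4 (by decide),
    hx 5 (by decide), hx 6 (by decide)] at h
  rw [← h]
  norm_num [Fin.val_ofNat]

end

/-! ### Six distinct points -/

section

variable {F : Type u} [Field F] {A : Type*} [AddCommGroup A] {c : LineTuple F 4 5 → A}

theorem isCosimple_double_first {s : Fin 4 → F} (hs : Function.Injective s) : IsCosimple (F := F)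
    (![(0, 1), (0, 1), (1, s 0), (1, s 1), (1, s 2), (1, s 3)] : Fin 6 → F × F) := by
  refine isCosimple_of_det (fun j k => ?_) ![3, 4, 5] (by decide) fun t => ?_
  · fin_cases j <;> fin_cases k <;> simp [det₂, sub_eq_zero, hs.eq_iff]
  · fin_cases t <;> simp

theorem isCosimple_double_last {s : Fin 4 → F} (hs : Function.Injective s) : IsCosimple (F := F)
    (![(1, s 0), (1, s 1), (1, s 2), (1, s 3), (0, 1), (0, 1)] : Fin 6 → F × F) := by
  refine isCosimple_of_det (fun j k => ?_) ![0, 1, 2] (by decide) fun t => ?_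
  · fin_cases j <;> fin_cases k <;> simp [det₂, sub_eq_zero, hs.eq_iff]
  · fin_cases t <;> simp

/-- The value of a cocycle at six distinct points of the affine line is zero. They are the projection
of two triples of collinear points of the plane from a point off the two lines; the projections
from the other six points have a double point in the first or last two positions. -/
theorem galeValue_affine [Infinite F] (hc : IsLineCocycle c) {y : Fin 6 → F}
    (hy : Function.Injective y) : galeValue c (fun j => ((1, y j) : F × F)) = 0 := by
  have hy' : ∀ i j, j ≠ i → y j - y i ≠ 0 := fun i j h => sub_ne_zero.2 (hy.ne h)
  -- The lines have equations `v.1 = 0` and `v.2.1 = 0`; the centre is `(1, 1, 0)`.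
  let u : Fin 7 → F × F × F := ![(0, 1, y 0), (0, 1, y 1), (0, 1, y 2), (1, 1, 0),
    (1, 0, -y 3), (1, 0, -y 4), (1, 0, -y 5)]
  let p : F → Fin 6 → F × F := fun t =>
    ![(0, 1), (0, 1), (1, -t), (1, -y 3), (1, -y 4), (1, -y 5)]
  let q : F → Fin 6 → F × F := fun t =>
    ![(1, y 0), (1, y 1), (1, y 2), (1, t), (0, 1), (0, 1)]
  have hp : ∀ i : Fin 6, i < 3 → galeValue c (p (y i)) = 0 ∧ IsCosimple (F := F) (p (y i)) := by
    intro i hi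
    have hinj : Function.Injective fun j : Fin 4 => -y (![i, 3, 4, 5] j) :=
      (neg_injective.comp hy).comp (by
        fin_cases i <;> first | decide | exact absurd hi (by decide))
    exact ⟨galeValue_double_first hc hinj, isCosimple_double_first hinj⟩
  have hq : ∀ i : Fin 6, 2 < i → galeValue c (q (y i)) = 0 ∧ IsCosimple (F := F) (q (y i)) := by
    intro i hi
    have hinj : Function.Injective fun j : Fin 4 => y (![0, 1, 2, i] j) :=
      hy.comp (by fin_cases i <;> first | decide | exact absurd hi (by decide))
    exact ⟨galeValue_double_last hc hinj, isCosimple_double_last hinj⟩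
  have hx : IsCosimple (F := F) (fun j => ((1, y j) : F × F)) :=
    isCosimple_of_pairwise_det fun j k hjk => by simpa [det₂] using hy' _ _ hjk.symm
  have h := hc.sum_galeValue u ![p (y 0), p (y 1), p (y 2), fun j => (1, y j),
    q (y 3), q (y 4), q (y 5)] (by
      intro i
      fin_cases i
      · refine isProjectedFamily_infinity rfl ![y 1 - y 0, y 2 - y 0, 1, 1, 1, 1] ?_ ?_
        · simp [Fin.forall_fin_succ, hy']
        · simp [Fin.forall_fin_succ, p, u, projInfinity, Fin.succAbove]
      · refine isProjectedFamily_infinity rfl ![y 0 - y 1, y 2 - y 1, 1, 1, 1, 1] ?_ ?_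
        · simp [Fin.forall_fin_succ, hy']
        · intro j; fin_cases j <;> simp [p, u, projInfinity, Fin.succAbove]
      · refine isProjectedFamily_infinity rfl ![y 0 - y 2, y 1 - y 2, 1, 1, 1, 1] ?_ ?_
        · simp [Fin.forall_fin_succ, hy']
        · intro j; fin_cases j <;> simp [p, u, projInfinity, Fin.succAbove]
      · refine isProjectedFamily_affine rfl ![1, 1, 1, -1, -1, -1] ?_ ?_
        · simp [Fin.forall_fin_succ]
        · intro j; fin_cases j <;> simp [u, projAffine, Fin.succAbove]
      · refine isProjectedFamily_affine rfl ![1, 1, 1, 1, y 3 - y 4, y 3 - y 5] ?_ ?_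
        · simp [Fin.forall_fin_succ, hy']
        · intro j; fin_cases j <;> simp [q, u, projAffine, Fin.succAbove, neg_add_eq_sub]
      · refine isProjectedFamily_affine rfl ![1, 1, 1, 1, y 4 - y 3, y 4 - y 5] ?_ ?_
        · simp [Fin.forall_fin_succ, hy']
        · intro j; fin_cases j <;> simp [q, u, projAffine, Fin.succAbove, neg_add_eq_sub]
      · refine isProjectedFamily_affine rfl ![1, 1, 1, 1, y 5 - y 3, y 5 - y 4] ?_ ?_
        · simp [Fin.forall_fin_succ, hy']
        · intro j; fin_cases j <;> simp [q, u, projAffine, Fin.succAbove, neg_add_eq_sub]) (by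
      intro i
      fin_cases i
      exacts [(hp 0 (by decide)).2, (hp 1 (by decide)).2, (hp 2 (by decide)).2, hx,
        (hq 3 (by decide)).2, (hq 4 (by decide)).2, (hq 5 (by decide)).2])
  have hz : ∀ i : Fin 7, i ≠ 3 → galeValue c ((![p (y 0), p (y 1), p (y 2), fun j => (1, y j),
      q (y 3), q (y 4), q (y 5)] : Fin 7 → Fin 6 → F × F) i) = 0 := by
    intro i hi
    fin_cases i
    exacts [(hp 0 (by decide)).1, (hp 1 (by decide)).1, (hp 2 (by decide)).1, (hi rfl).elim,
      (hq 3 (by decide)).1, (hq 4 (by decide)).1, (hq 5 (by decide)).1]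
  rw [Finset.sum_eq_single 3 (fun i _ hi => by rw [hz i hi, smul_zero]) (by simp)] at h
  have h3 : ((3 : Fin 7) : ℕ) = 3 := rfl
  simpa [h3, pow_succ] using h

/-- The value of a cocycle at six pairwise independent vectors of the plane is zero. -/
theorem galeValue_eq_zero_of_pairwise_det [Infinite F] (hc : IsLineCocycle c) {x : Fin 6 → F × F}
    (hdet : ∀ j k, j ≠ k → det₂ (x j) (x k) ≠ 0) : galeValue c x = 0 := by
  have hx0 : ∀ j, x j ≠ 0 := by
    intro j hj
    obtain ⟨k, hk⟩ := exists_ne j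
    exact hdet j k hk.symm (by simp [hj, det₂])
  -- A linear form that vanishes at none of the six points.
  obtain ⟨t, ht⟩ : ∃ t : F, ∀ j, (x j).1 + t * (x j).2 ≠ 0 := by
    obtain ⟨t, ht⟩ := (Set.finite_range fun j => -(x j).1 / (x j).2).infinite_compl.nonempty
    refine ⟨t, fun j hj => ?_⟩
    by_cases h2 : (x j).2 = 0
    · rw [h2, mul_zero, add_zero] at hj
      exact hx0 j (Prod.ext hj h2)
    · refine ht ⟨j, ?_⟩
      rw [div_eq_iff h2]
      linear_combination -hj
  let φ : (F × F) ≃ₗ[F] (F × F) :=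
    { toFun := fun v => (v.1 + t * v.2, v.2)
      map_add' := fun v w => Prod.ext (by simp; ring) rfl
      map_smul' := fun r v => Prod.ext (by simp; ring) rfl
      invFun := fun v => (v.1 - t * v.2, v.2)
      left_inv := fun v => Prod.ext (by simp) rfl
      right_inv := fun v => Prod.ext (by simp) rfl }
  rw [galeValue_congr c φ (fun j => (x j).1 + t * (x j).2) ht
    (x' := fun j => (1, (x j).2 / ((x j).1 + t * (x j).2)))]
  · refine galeValue_affine hc fun j k hjk => ?_
    by_contra hne
    refine hdet j k hne ?_
    have := (div_eq_div_iff (ht j) (ht k)).1 hjk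
    rw [det₂]
    linear_combination -this
  · intro j
    refine Prod.ext (by simp [φ]) ?_
    simp [φ, mul_div_cancel₀ _ (ht j)]

end

/-! ### Points at infinity -/

section

variable {F : Type u} [Field F] {A : Type*} [AddCommGroup A] {c : LineTuple F 4 5 → A}

/-- The configuration on the projective line with the members of `S` at infinity, and the other
points at the positions `y` on the affine line. -/
def pointsWithInfinity {ι : Type*} (S : ι → Prop) [DecidablePred S] (y : ι → F) (j : ι) : F × F :=
  if S j then (0, 1) else (1, y j)

theorem isCosimple_pointsWithInfinity {S : Fin 6 → Prop} [DecidablePred S] {y : Fin 6 → F}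
    (e : Fin 3 → Fin 6) (he : Function.Injective e) (heS : ∀ t, ¬ S (e t))
    (hy : ∀ j k, j ≠ k → ¬ S j → ¬ S k → y j ≠ y k) :
    IsCosimple (F := F) (pointsWithInfinity S y) := by
  refine isCosimple_of_det (fun j k hjk => ?_) e he fun t => by simp [pointsWithInfinity, heS]
  by_cases hj : S j <;> by_cases hk : S k <;> simp [pointsWithInfinity, hj, hk, det₂, sub_eq_zero]
  exact fun h => hy j k hjk hj hk h.symm

/-- Moving the finite points from `y` to `y'` does not change the value of a cocycle, if the points
`(y j, y' j)` are in general position. -/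
theorem galeValue_pointsWithInfinity_eq_of_general [Infinite F] (hc : IsLineCocycle c)
    {S : Fin 6 → Prop} [DecidablePred S] {y y' : Fin 6 → F}
    (e : Fin 3 → Fin 6) (he : Function.Injective e) (heS : ∀ t, ¬ S (e t))
    (hy : ∀ j k, j ≠ k → ¬ S j → ¬ S k → y j ≠ y k)
    (hy' : ∀ j k, j ≠ k → ¬ S j → ¬ S k → y' j ≠ y' k)
    (hyy' : ∀ i j k, i ≠ j → i ≠ k → j ≠ k → ¬ S i → ¬ S j → ¬ S k →
      (y j - y i) * (y' k - y' i) - (y k - y i) * (y' j - y' i) ≠ 0) :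
    galeValue c (pointsWithInfinity S y) = galeValue c (pointsWithInfinity S y') := by
  -- Projecting the points `(a j, y j)` of the plane along the directions of slope `0` and `1` yields
  -- `y` and `y'`. Replacing one slope by the other in a configuration of seven points, the members
  -- of `S` being at infinity at other slopes, changes only the term projecting from that point:
  -- the projections from other points at infinity stay the same up to scaling, and those from the
  -- finite points consist of pairwise independent vectors, where the cocycle vanishes.
  let a : Fin 6 → F := fun j => y j - y' j
  have hfin : (insert 0 (insert 1 (Set.range fun p : Fin 6 × Fin 6 =>
    (y p.1 - y p.2) / (a p.1 - a p.2))) : Set F).Finite :=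
    ((Set.finite_range _).insert _).insert _
  obtain ⟨s⟩ := exists_embedding_compl hfin 6
  have hs0 : ∀ j, (s j : F) ≠ 0 := fun j h => (s j).2 (by simp [h])
  have hs1 : ∀ j, (s j : F) ≠ 1 := fun j h => (s j).2 (by simp [h])
  have hsj : ∀ j k, j ≠ k → (s k : F) - s j ≠ 0 := fun j k hjk h =>
    hjk (s.injective (Subtype.ext (sub_eq_zero.1 h).symm))
  have hslope : ∀ i j k, j ≠ k → ¬ S j → ¬ S k → (y j - y k) - s i * (a j - a k) ≠ 0 := by
    intro i j k hjk hj hk h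
    by_cases h0 : a j - a k = 0
    · rw [h0, mul_zero, sub_zero, sub_eq_zero] at h
      exact hy j k hjk hj hk h
    · refine (s i).2 (Set.mem_insert_of_mem _ (Set.mem_insert_of_mem _ ⟨(j, k), ?_⟩))
      rw [div_eq_iff h0]
      linear_combination h
  let u : F → Fin 7 → F × F × F := fun s₀ => Fin.cons (0, 1, s₀)
    fun j => if S j then (0, 1, (s j : F)) else (1, a j, y j)
  let z : Fin 6 → Fin 6 → F × F := fun i => if S i then
    Fin.cons (0, 1) fun m => if S (i.succAbove m) then (0, 1) else
      (1, y (i.succAbove m) - s i * a (i.succAbove m)) else 0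
  have hz : ∀ i, S i → IsCosimple (F := F) (z i) := by
    intro i hi
    have hm : ∀ t, ∃ m, i.succAbove m = e t := fun t =>
      Fin.exists_succAbove_eq fun h => heS t (h ▸ hi)
    choose m hm using hm
    refine isCosimple_of_det ?_ (fun t => (m t).succ) (fun t t' h => ?_) (fun t => ?_)
    · refine Fin.cases (fun k _ h => (h (by simp [z, hi])).elim) fun j => Fin.cases (fun _ h => ?_)
        fun k hjk h => ?_
      · by_cases hj : S (i.succAbove j)
        · exact (h (by simp [z, hi, hj])).elim
        · simp [z, hi, hj, det₂]
      · by_cases hj : S (i.succAbove j)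
        · exact (h (by simp [z, hi, hj])).elim
        · by_cases hk : S (i.succAbove k)
          · simp [z, hi, hj, hk, det₂]
          · have := hslope i (i.succAbove k) (i.succAbove j) (by simpa using Ne.symm hjk) hk hj
            simp only [z, hi, hj, hk, det₂, Fin.cons_succ, if_true, if_false]
            intro h'
            refine this ?_
            linear_combination h'
    · exact he (by rw [← hm, ← hm, Fin.succ_injective _ h])
    · simp [z, hi, hm, heS]
  have key : ∀ s₀ : F, s₀ = 0 ∨ s₀ = 1 →
      galeValue c (pointsWithInfinity S fun j => y j - s₀ * a j) +
        ∑ i : Fin 6, (-1 : ℤ) ^ (i.succ : ℕ) • (if S i then galeValue c (z i) else 0) = 0 := by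
    intro s₀ hs₀
    have hss₀ : ∀ j, (s j : F) ≠ s₀ := by
      rcases hs₀ with rfl | rfl
      exacts [hs0, hs1]
    let w : Fin 6 → Fin 6 → F × F := fun i m => projAffine (a i) (y i) (u s₀ (i.succ.succAbove m))
    have hy₀ : ∀ j k, j ≠ k → ¬ S j → ¬ S k → y j - s₀ * a j ≠ y k - s₀ * a k := by
      intro j k hjk hj hk
      rcases hs₀ with rfl | rfl
      · simpa using hy j k hjk hj hk
      · simpa [a] using hy' j k hjk hj hk
    have hw : ∀ i, ¬ S i → ∀ m n, m ≠ n → det₂ (w i m) (w i n) ≠ 0 := by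
      intro i hi
      have hw0 : w i 0 = (1, s₀) := by simp [w, u, projAffine]
      have hwS : ∀ m, S (i.succAbove m) → w i m.succ = (1, (s (i.succAbove m) : F)) := by
        intro m hm
        simp [w, u, projAffine, hm]
      have hwA : ∀ m, ¬ S (i.succAbove m) → w i m.succ =
          (a (i.succAbove m) - a i, y (i.succAbove m) - y i) := by
        intro m hm
        simp [w, u, projAffine, hm]
      have hswap : ∀ p q : F × F, det₂ p q ≠ 0 → det₂ q p ≠ 0 := by
        intro p q h h'
        refine h ?_
        simp only [det₂] at h' ⊢
        linear_combination -h'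
      have hsucc : ∀ m : Fin 5, det₂ (w i 0) (w i m.succ) ≠ 0 := by
        intro m
        rw [hw0]
        by_cases hm : S (i.succAbove m)
        · rw [hwS m hm]
          simpa [det₂, sub_eq_zero] using hss₀ _
        · rw [hwA m hm]
          have := hy₀ _ _ (Fin.succAbove_ne i m) hm hi
          intro h
          refine this ?_
          simp only [det₂] at h
          linear_combination h
      have hsa : ∀ m n, S (i.succAbove m) → ¬ S (i.succAbove n) →
          det₂ (w i m.succ) (w i n.succ) ≠ 0 := by
        intro m n hm hn
        rw [hwS m hm, hwA n hn]
        simpa [det₂] using hslope (i.succAbove m) _ _ (Fin.succAbove_ne i n) hn hi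
      refine Fin.cases (Fin.cases (fun h => (h rfl).elim) fun n _ => hsucc n)
        fun m => Fin.cases (fun _ => hswap _ _ (hsucc m)) fun n hmn => ?_
      have hmn' : i.succAbove m ≠ i.succAbove n := by simpa using hmn
      by_cases hm : S (i.succAbove m) <;> by_cases hn : S (i.succAbove n)
      · rw [hwS m hm, hwS n hn]
        simpa [det₂] using hsj _ _ hmn'
      · exact hsa m n hm hn
      · exact hswap _ _ (hsa n m hn hm)
      · rw [hwA m hm, hwA n hn]
        intro h
        refine hyy' i _ _ (Fin.succAbove_ne i m).symm (Fin.succAbove_ne i n).symm hmn' hi hm hn ?_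
        simp only [det₂, a] at h
        linear_combination h
    have h := hc.sum_galeValue (u s₀) (Fin.cons (pointsWithInfinity S fun j => y j - s₀ * a j)
      fun i => if S i then z i else w i) ?_ ?_
    · rw [Fin.sum_univ_succ] at h
      simp only [Fin.cons_zero, Fin.cons_succ, Fin.val_zero, pow_zero, one_smul] at h
      refine Eq.trans (congrArg _ ?_) h
      refine Finset.sum_congr rfl fun i _ => ?_
      by_cases hi : S i
      · simp only [if_pos hi]
      · simp only [if_neg hi, galeValue_eq_zero_of_pairwise_det hc (hw i hi)]
    · refine Fin.cases ?_ fun i => ?_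
      · refine isProjectedFamily_infinity (s := s₀) rfl (fun j => if S j then s j - s₀ else 1)
          (fun j => ?_) fun j => ?_
        · split_ifs
          exacts [sub_ne_zero.2 (hss₀ j), one_ne_zero]
        · by_cases hj : S j <;> simp [u, pointsWithInfinity, projInfinity, hj]
      · by_cases hi : S i
        · refine isProjectedFamily_infinity (s := (s i : F)) (by simp [u, hi])
            (Fin.cons (s₀ - s i) fun m =>
              if S (i.succAbove m) then s (i.succAbove m) - s i else 1)
            (Fin.cases ?_ fun m => ?_) (Fin.cases ?_ fun m => ?_)
          · simpa using sub_ne_zero.2 (hss₀ i).symm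
          · simp only [Fin.cons_succ]
            split_ifs
            exacts [hsj _ _ (Fin.succAbove_ne i m).symm, one_ne_zero]
          · simp [u, z, projInfinity, hi]
          · by_cases hm : S (i.succAbove m) <;> simp [u, z, projInfinity, hi, hm]
        · refine isProjectedFamily_affine (a := a i) (b := y i) (by simp [u, hi]) (fun _ => 1)
            (fun _ => one_ne_zero) fun j => ?_
          simp [w, hi]
    · refine Fin.cases ?_ fun i => ?_
      · exact isCosimple_pointsWithInfinity e he heS hy₀
      · rw [Fin.cons_succ]
        by_cases hi : S i
        · rw [if_pos hi]
          exact hz i hi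
        · rw [if_neg hi]
          exact isCosimple_of_pairwise_det (hw i hi)
  have h0 := key 0 (Or.inl rfl)
  have h1 := key 1 (Or.inr rfl)
  simp only [zero_mul, sub_zero] at h0
  simp only [a, one_mul, sub_sub_cancel] at h1
  exact add_right_cancel (h0.trans h1.symm)

/-- The value of a cocycle at a configuration with some members at infinity does not depend on the
position of the finite points. -/
theorem galeValue_pointsWithInfinity_eq [Infinite F] (hc : IsLineCocycle c)
    {S : Fin 6 → Prop} [DecidablePred S] {y y' : Fin 6 → F}
    (e : Fin 3 → Fin 6) (he : Function.Injective e) (heS : ∀ t, ¬ S (e t))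
    (hy : ∀ j k, j ≠ k → ¬ S j → ¬ S k → y j ≠ y k)
    (hy' : ∀ j k, j ≠ k → ¬ S j → ¬ S k → y' j ≠ y' k) :
    galeValue c (pointsWithInfinity S y) = galeValue c (pointsWithInfinity S y') := by
  let P := {p : Fin 6 × Fin 6 // p.1 ≠ p.2}
  let T := {p : Fin 6 × Fin 6 × Fin 6 // (p.1 ≠ p.2.1 ∧ p.1 ≠ p.2.2 ∧ p.2.1 ≠ p.2.2) ∧
    ¬ S p.1 ∧ ¬ S p.2.1 ∧ ¬ S p.2.2}
  let pr : Fin 6 → Module.Dual F (Fin 6 → F) := LinearMap.proj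
  -- The vectors to be avoided lie on finitely many hyperplanes.
  let g : (Fin 6 → F) → T → Module.Dual F (Fin 6 → F) := fun y p =>
    (y p.1.2.1 - y p.1.1) • (pr p.1.2.2 - pr p.1.1) -
      (y p.1.2.2 - y p.1.1) • (pr p.1.2.1 - pr p.1.1)
  have hg : ∀ y : Fin 6 → F, (∀ j k, j ≠ k → ¬ S j → ¬ S k → y j ≠ y k) → ∀ p, ∃ v, g y p v ≠ 0 := by
    rintro y hy ⟨⟨i, j, k⟩, ⟨hij, hik, hjk⟩, hi, hj, hk⟩
    refine ⟨Pi.single k 1, ?_⟩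
    have := hy j i hij.symm hj hi
    simpa [g, pr, hik, hjk, sub_eq_zero] using this
  obtain ⟨v, hv⟩ := Module.Dual.exists_forall_ne_zero_of_forall_exists
    (Sum.elim (fun p : P => pr p.1.1 - pr p.1.2) (Sum.elim (g y) (g y'))) (by
      rintro (⟨⟨j, k⟩, hjk⟩ | p | p)
      · refine ⟨Pi.single j 1, ?_⟩
        have hjk : j ≠ k := hjk
        simp [pr, hjk]
      · exact hg y hy p
      · exact hg y' hy' p)
  have hv0 : ∀ j k, j ≠ k → ¬ S j → ¬ S k → v j ≠ v k := fun j k hjk _ _ =>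
    sub_ne_zero.1 (by simpa [pr] using hv (Sum.inl ⟨(j, k), hjk⟩))
  rw [galeValue_pointsWithInfinity_eq_of_general hc e he heS hy hv0,
    galeValue_pointsWithInfinity_eq_of_general hc e he heS hy' hv0]
  · intro i j k hij hik hjk hi hj hk
    simpa [g, pr] using hv (Sum.inr (Sum.inr ⟨(i, j, k), ⟨hij, hik, hjk⟩, hi, hj, hk⟩))
  · intro i j k hij hik hjk hi hj hk
    simpa [g, pr] using hv (Sum.inr (Sum.inl ⟨(i, j, k), ⟨hij, hik, hjk⟩, hi, hj, hk⟩))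

end

/-! ### Cones over at most five lines -/

section

variable {F : Type u} [Field F]

theorem mem_span_image_iff {m n : ℕ} {W : Fin m → Fin n → F} {J : Set (Fin m)} {v : Fin n → F} :
    v ∈ Submodule.span F (W '' J) ↔ ∃ c : Fin m → F, (∀ k, k ∉ J → c k = 0) ∧ ∑ k, c k • W k = v := by
  classical
  constructor
  · intro h
    induction h using Submodule.span_induction with
    | mem x hx =>
      obtain ⟨j, hj, rfl⟩ := hx
      refine ⟨Pi.single j 1, fun k hk => Pi.single_eq_of_ne (by rintro rfl; exact hk hj) _, ?_⟩
      rw [Finset.sum_eq_single j] <;> simp +contextual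
    | zero => exact ⟨0, by simp⟩
    | add x y _ _ hx hy =>
      obtain ⟨c, hc, rfl⟩ := hx
      obtain ⟨d, hd, rfl⟩ := hy
      exact ⟨c + d, fun k hk => by simp [hc k hk, hd k hk],
        by simp [add_smul, Finset.sum_add_distrib]⟩
    | smul a x _ hx =>
      obtain ⟨c, hc, rfl⟩ := hx
      exact ⟨a • c, fun k hk => by simp [hc k hk], by simp [mul_smul, Finset.smul_sum]⟩
  · rintro ⟨c, hc, rfl⟩
    refine Submodule.sum_mem _ fun k _ => ?_
    by_cases hk : k ∈ J
    · exact Submodule.smul_mem _ _ (Submodule.subset_span ⟨k, hk, rfl⟩)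
    · rw [hc k hk, zero_smul]
      exact Submodule.zero_mem _

theorem span_image_ne_top {m n : ℕ} (W : Fin m → Fin n → F) (J : Finset (Fin m)) (hJ : J.card < n) :
    Submodule.span F (W '' (J : Set (Fin m))) ≠ ⊤ := by
  classical
  intro h
  have h1 := finrank_span_finset_le_card (R := F) (J.image W)
  rw [Finset.coe_image] at h1
  unfold Set.finrank at h1
  rw [h, finrank_top, Module.finrank_fin_fun] at h1
  have := Finset.card_image_le (s := J) (f := W)
  omega

theorem sum_cons_smul {m n : ℕ} (W : Fin m → Fin n → F) (v : Fin n → F) (c : Fin (m + 1) → F) :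
    ∑ j, c j • (Fin.cons v W : Fin (m + 1) → Fin n → F) j =
      c 0 • v + ∑ j : Fin m, c j.succ • W j := by
  rw [Fin.sum_univ_succ]
  simp

namespace LineTuple

variable {n l : ℕ}

/-- If the lines of `w` do not span the space, all generic cones over `w` lie in one orbit. -/
theorem exists_smul_eq_of_span_ne_top {W : Fin (l + 1) → Fin n → F} {v v' : Fin n → F}
    {t t' : LineTuple F n (l + 1)} (ht : t.IsSpannedBy (Fin.cons v W))
    (ht' : t'.IsSpannedBy (Fin.cons v' W)) (hv : IsGenericVector W v) (hv' : IsGenericVector W v')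
    (hW : Submodule.span F (Set.range W) ≠ ⊤) : ∃ g : GL (Fin n) F, g • t = t' := by
  have key : ∀ v, IsGenericVector W v → ∀ c : Fin (l + 2) → F,
      ∑ j, c j • (Fin.cons v W : Fin (l + 2) → Fin n → F) j = 0 ↔
        c 0 = 0 ∧ ∑ j : Fin (l + 1), c j.succ • W j = 0 := by
    intro v hv c
    rw [sum_cons_smul]
    constructor
    · intro h
      have h0 : c 0 = 0 := by
        by_contra h0
        refine hv Set.univ (by rwa [Set.image_univ]) (mem_span_image_iff.2
          ⟨fun j => -(c 0)⁻¹ * c j.succ, by simp, ?_⟩)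
        simp only [mul_smul, ← Finset.smul_sum]
        rw [eq_neg_of_add_eq_zero_right h, smul_neg, neg_smul, neg_neg, smul_smul,
          inv_mul_cancel₀ h0, one_smul]
      rw [h0, zero_smul, zero_add] at h
      exact ⟨h0, h⟩
    · rintro ⟨h0, h⟩
      rw [h0, h, zero_smul, zero_add]
  exact ht.exists_smul_eq ht' fun c => (key v hv c).trans (key v' hv' c).symm

/-- The generic cones over a basis lie in one orbit. -/
theorem exists_smul_eq_of_basis {W : Fin (l + 1) → Fin (l + 1) → F} {v v' : Fin (l + 1) → F}
    {t t' : LineTuple F (l + 1) (l + 1)} (ht : t.IsSpannedBy (Fin.cons v W))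
    (ht' : t'.IsSpannedBy (Fin.cons v' W)) (hv : IsGenericVector W v) (hv' : IsGenericVector W v')
    (hW : Submodule.span F (Set.range W) = ⊤) : ∃ g : GL (Fin (l + 1)) F, g • t = t' := by
  have hli : LinearIndependent F W := linearIndependent_of_top_le_span_of_card_eq_finrank hW.ge
    (by simp)
  have key : ∀ v (t : LineTuple F (l + 1) (l + 1)), IsGenericVector W v →
      t.IsSpannedBy (Fin.cons v W) →
      ∃ W' : Fin (l + 2) → Fin (l + 1) → F, t.IsSpannedBy W' ∧
        ∀ c : Fin (l + 2) → F, ∑ j, c j • W' j = 0 ↔ ∀ j : Fin (l + 1), c 0 + c j.succ = 0 := by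
    intro v t hv ht
    have hvm : v ∈ Submodule.span F (W '' Set.univ) := by rw [Set.image_univ, hW]; trivial
    obtain ⟨z, -, hz⟩ := mem_span_image_iff.1 hvm
    have hz0 : ∀ j, z j ≠ 0 := by
      intro j hj
      refine hv _ (span_image_ne_top W (Finset.univ.erase j) ?_)
        (mem_span_image_iff.2 ⟨z, fun k hk => ?_, hz⟩)
      · simp
      · have : k = j := by simpa using hk
        rw [this, hj]
    refine ⟨_, ht.rescale (a := Fin.cons 1 z) (Fin.cases (by simp) (by simpa using hz0)),
      fun c => ?_⟩
    rw [Fin.sum_univ_succ]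
    simp only [Fin.cons_zero, Fin.cons_succ, one_smul]
    rw [← hz, Finset.smul_sum, ← Finset.sum_add_distrib]
    have : ∀ j, c 0 • z j • W j + c j.succ • z j • W j = ((c 0 + c j.succ) * z j) • W j := by
      intro j
      rw [smul_smul, smul_smul, ← add_smul, add_mul]
    simp only [this]
    constructor
    · intro h j
      exact (mul_eq_zero.1 (Fintype.linearIndependent_iff.1 hli _ h j)).resolve_right (hz0 j)
    · intro h
      simp [h]
  obtain ⟨W₁, h₁, hc₁⟩ := key v t hv ht
  obtain ⟨W₂, h₂, hc₂⟩ := key v' t' hv' ht'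
  exact h₁.exists_smul_eq h₂ fun c => (hc₁ c).trans (hc₂ c).symm

open Classical in
/-- The Gale dual of a generic cone over five lines that span the space: if `x` is the linear
relation of the five lines, the new line and the lines not involved in the relation are dual to
the point at infinity of the projective line, and the other lines to distinct finite points. -/
theorem exists_hasGaleDual_genericCone {W : Fin 5 → Fin 4 → F} {x : Fin 5 → F}
    (hx : ∀ c : Fin 5 → F, ∑ j, c j • W j = 0 ↔ ∃ r : F, ∀ j, c j = r * x j)
    {v : Fin 4 → F} (hW : Submodule.span F (Set.range W) = ⊤) (hv : IsGenericVector W v)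
    {t : LineTuple F 4 5} (ht : t.IsSpannedBy (Fin.cons v W)) :
    ∃ y : Fin 6 → F, t.HasGaleDual
        (pointsWithInfinity (Fin.cons True fun j => x j = 0 : Fin 6 → Prop) y) ∧
      ∀ j k : Fin 6, j ≠ k → ¬ (Fin.cons True fun j => x j = 0 : Fin 6 → Prop) j →
        ¬ (Fin.cons True fun j => x j = 0 : Fin 6 → Prop) k → y j ≠ y k := by
  have hvm : -v ∈ Submodule.span F (W '' Set.univ) := by rw [Set.image_univ, hW]; trivial
  obtain ⟨z, -, hz⟩ := mem_span_image_iff.1 hvm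
  have hvz : ∀ r : F, ∑ k, (-(z k - r * x k)) • W k = v := by
    intro r
    have : ∑ k, (r * x k) • W k = 0 := (hx _).2 ⟨r, fun j => rfl⟩
    simp only [neg_smul, sub_smul, Finset.sum_neg_distrib, Finset.sum_sub_distrib, hz, this]
    simp
  have hz0 : ∀ j, x j = 0 → z j ≠ 0 := by
    intro j hxj hj
    refine hv {j}ᶜ (fun htop => ?_) (mem_span_image_iff.2 ⟨_, fun k hk => ?_, hvz 0⟩)
    · have hWj : W j ∈ Submodule.span F (W '' {j}ᶜ) := by rw [htop]; trivial
      obtain ⟨c, hc, hcW⟩ := mem_span_image_iff.1 hWj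
      obtain ⟨r, hr⟩ := (hx (c - Pi.single j 1)).1 (by
        simp only [Pi.sub_apply, sub_smul, Finset.sum_sub_distrib, hcW]
        rw [Finset.sum_eq_single j] <;> simp +contextual)
      have := hr j
      rw [hxj, mul_zero, Pi.sub_apply, hc j (by simp)] at this
      simp at this
    · have : k = j := by simpa using hk
      simp [this, hj]
  have hne : ∀ j k, j ≠ k → x j ≠ 0 → x k ≠ 0 → z j / x j ≠ z k / x k := by
    intro j k hjk hj hk h
    refine hv _ (span_image_ne_top W ({j, k} : Finset (Fin 5))ᶜ ?_)
      (mem_span_image_iff.2 ⟨_, fun i hi => ?_, hvz (z j / x j)⟩)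
    · rw [Finset.card_compl, Finset.card_pair hjk]
      simp
    · have : i = j ∨ i = k := by simpa [or_iff_not_imp_right] using hi
      rcases this with rfl | rfl
      · rw [div_mul_cancel₀ _ hj, sub_self, neg_zero]
      · rw [h, div_mul_cancel₀ _ hk, sub_self, neg_zero]
  have hdual : t.HasGaleDual (Fin.cons (0, 1) fun j => (x j, z j) : Fin 6 → F × F) := by
    refine ⟨_, ht, fun c => ?_⟩
    rw [sum_cons_smul]
    have : c 0 • v + ∑ j : Fin 5, c j.succ • W j = ∑ j : Fin 5, (c j.succ - c 0 * z j) • W j := by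
      rw [← neg_neg v, ← hz, smul_neg, Finset.smul_sum, neg_add_eq_sub, ← Finset.sum_sub_distrib]
      simp only [sub_smul, mul_smul]
    rw [this, hx fun j => c j.succ - c 0 * z j]
    constructor
    · rintro ⟨r, hr⟩
      refine ⟨r • LinearMap.fst F F F + c 0 • LinearMap.snd F F F,
        Fin.cases (by simp) fun j => ?_⟩
      simpa [sub_eq_iff_eq_add] using hr j
    · rintro ⟨f, hf⟩
      refine ⟨f (1, 0), fun j => ?_⟩
      have h0 := hf 0
      have h1 := hf j.succ
      simp only [Fin.cons_zero, Fin.cons_succ] at h0 h1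
      have h2 : ((x j, z j) : F × F) = x j • (1, 0) + z j • (0, 1) := by ext <;> simp
      rw [h1, h2, map_add, map_smul, map_smul, h0, smul_eq_mul, smul_eq_mul]
      ring
  refine ⟨Fin.cons 0 fun j => z j / x j, hdual.congr (LinearEquiv.refl F _)
    (Fin.cons 1 fun j => if x j = 0 then z j else x j) ?_ ?_, ?_⟩
  · refine Fin.cases (by simp) fun j => ?_
    by_cases hj : x j = 0
    · simpa [hj] using hz0 j hj
    · simp [hj]
  · refine Fin.cases (by simp [pointsWithInfinity]) fun j => ?_
    by_cases hj : x j = 0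
    · simp [pointsWithInfinity, hj]
    · simp [pointsWithInfinity, hj, mul_div_cancel₀]
  · refine Fin.cases (by simp) fun j => Fin.cases (by simp) fun k hjk hj hk => ?_
    simpa using hne j k (fun h => hjk (congrArg _ h)) (by simpa using hj) (by simpa using hk)

/-- Five vectors spanning `F⁴` have a unique linear relation, up to scaling. -/
theorem exists_relation {W : Fin 5 → Fin 4 → F} (hW : Submodule.span F (Set.range W) = ⊤) :
    ∃ x : Fin 5 → F, x ≠ 0 ∧
      ∀ c : Fin 5 → F, ∑ j, c j • W j = 0 ↔ ∃ r : F, ∀ j, c j = r * x j := by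
  let T := Fintype.linearCombination F W
  have hT : LinearMap.range T = ⊤ := by rw [Fintype.range_linearCombination, hW]
  have hker : Module.finrank F (LinearMap.ker T) = 1 := by
    have := LinearMap.finrank_range_add_finrank_ker T
    rw [hT, finrank_top, Module.finrank_fin_fun, Module.finrank_fin_fun] at this
    omega
  obtain ⟨x, hx0, hx⟩ := finrank_eq_one_iff'.1 hker
  have hxW : ∑ j, x.1 j • W j = 0 := x.2
  refine ⟨x.1, fun h => hx0 (Subtype.ext h), fun c => ⟨fun hc => ?_, ?_⟩⟩
  · obtain ⟨r, hr⟩ := hx ⟨c, hc⟩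
    exact ⟨r, fun j => (congrFun (congrArg Subtype.val hr) j).symm⟩
  · rintro ⟨r, hr⟩
    simp only [hr, mul_smul, ← Finset.smul_sum, hxW, smul_zero]

theorem IsSpannedBy.exists_three_ne_zero {w : LineTuple F n l} {W : Fin (l + 1) → Fin n → F}
    (hw : w.IsSpannedBy W) {x : Fin (l + 1) → F} (hx0 : x ≠ 0) (hx : ∑ j, x j • W j = 0) :
    ∃ e : Fin 3 → Fin (l + 1), Function.Injective e ∧ ∀ t, x (e t) ≠ 0 := by
  obtain ⟨i, hi⟩ := Function.ne_iff.1 hx0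
  obtain ⟨j, hji, hj⟩ : ∃ j, j ≠ i ∧ x j ≠ 0 := by
    by_contra! h
    rw [Finset.sum_eq_single i (fun k _ hk => by rw [h k hk, zero_smul]) (by simp)] at hx
    exact (smul_ne_zero hi (hw i).choose) hx
  obtain ⟨k, hki, hkj, hk⟩ : ∃ k, k ≠ i ∧ k ≠ j ∧ x k ≠ 0 := by
    by_contra! h
    rw [← Finset.sum_subset (Finset.subset_univ {i, j}) (fun k _ hk => by
      have hk : k ≠ i ∧ k ≠ j := by simpa using hk
      rw [h k hk.1 hk.2, zero_smul]), Finset.sum_pair hji.symm] at hx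
    refine hw.smul_ne hji.symm (-(x i)⁻¹ * x j) ?_
    rw [mul_smul, eq_neg_of_add_eq_zero_right hx, smul_neg, neg_smul, neg_neg, smul_smul,
      inv_mul_cancel₀ hi, one_smul]
  refine ⟨![i, j, k], ?_, ?_⟩
  · intro a b
    fin_cases a <;> fin_cases b <;> simp [hji, hji.symm, hki, hki.symm, hkj, hkj.symm]
  · intro t
    fin_cases t
    exacts [hi, hj, hk]

end LineTuple

/-- A cocycle takes the same value on all generic cones over a tuple of at most five lines. Unless
there are five lines that span the space, such cones form one orbit. -/
theorem IsLineCocycle.eq_of_isGenericCone [Infinite F] {l : ℕ} (hl : l ≤ 4) {A : Type*}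
    [AddCommGroup A] {c : LineTuple F 4 (l + 1) → A} (hc : IsLineCocycle c) {w : LineTuple F 4 l}
    {t t' : LineTuple F 4 (l + 1)} (ht : w.IsGenericCone t) (ht' : w.IsGenericCone t') :
    c t = c t' := by
  classical
  obtain ⟨W, v, hW, hv, ht⟩ := ht
  obtain ⟨W', v', hW', hv', ht'⟩ := ht'
  obtain ⟨a, ha, haW⟩ := hW.exists_rescale hW'
  obtain rfl : W = fun j => a j • W' j := funext haW
  replace hv' := hv'.rescale ha
  replace ht' := ht'.rescale (a := Fin.cons 1 a) (Fin.cases (by simp) (by simpa using ha))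
  have hcons : (fun j => (Fin.cons 1 a : Fin (l + 2) → F) j •
      (Fin.cons v' W' : Fin (l + 2) → Fin 4 → F) j) = Fin.cons v' fun j => a j • W' j := by
    funext j
    refine Fin.cases ?_ (fun j => ?_) j <;> simp
  rw [hcons] at ht'
  generalize (fun j => a j • W' j) = W at *
  by_cases hspan : Submodule.span F (Set.range W) = ⊤
  · have h3 : 3 ≤ l := by
      by_contra! h
      refine span_image_ne_top W Finset.univ (by simp; omega) ?_
      rw [Finset.coe_univ, Set.image_univ, hspan]
    obtain rfl | rfl : l = 3 ∨ l = 4 := by omega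
    · obtain ⟨g, rfl⟩ := LineTuple.exists_smul_eq_of_basis ht ht' hv hv' hspan
      exact (hc.smul g t).symm
    · obtain ⟨x, hx0, hx⟩ := LineTuple.exists_relation hspan
      obtain ⟨e, he, hex⟩ := hW.exists_three_ne_zero hx0
        ((hx x).2 ⟨1, fun j => (one_mul _).symm⟩)
      obtain ⟨y, hty, hy⟩ := LineTuple.exists_hasGaleDual_genericCone hx hspan hv ht
      obtain ⟨y', hty', hy'⟩ := LineTuple.exists_hasGaleDual_genericCone hx hspan hv' ht'
      rw [← hty.galeValue_eq hc.smul, ← hty'.galeValue_eq hc.smul]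
      exact galeValue_pointsWithInfinity_eq hc (fun t => (e t).succ)
        ((Fin.succ_injective _).comp he) (by simpa using hex) hy hy'
  · obtain ⟨g, rfl⟩ := LineTuple.exists_smul_eq_of_span_ne_top ht ht' hv hv' hspan
    exact (hc.smul g t).symm

theorem cocyclesAreCoboundaries [Infinite F] {l : ℕ} (hl : l ≤ 4) :
    CocyclesAreCoboundaries F 4 l :=
  cocyclesAreCoboundaries_of_genericCone (by norm_num) fun _ _ _ hc _ _ _ ht ht' =>
    hc.eq_of_isGenericCone hl ht ht'

theorem LineTuple.exists_smul_eq_of_single {n : ℕ} (w w' : LineTuple F n 0) :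
    ∃ g : GL (Fin n) F, g • w = w' :=
  w.isSpannedBy_rep.exists_smul_eq w'.isSpannedBy_rep fun c => by
    simp [Projectivization.rep_nonzero]

end

/-! ### Exactness -/

/-- `ULift.{u} ℤ` is the ring of integers, placed in the universe of `F`. -/
theorem lemma5p1 (F : Type u) [Field F] [Infinite F] :
    (∀ p : ℕ, p ≤ 6 →
      Limits.IsZero (pageTwo (lineDoubleComplex (ULift.{u} ℤ) F 4) p 0)) ∧
    Limits.IsZero ((lineCoinvariants (ULift.{u} ℤ) F 4).homology 5) := by
  refine ⟨fun p hp => ?_,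
    (lineCoinvariants_exactAt _ (cocyclesAreCoboundaries (by norm_num))).isZero_homology⟩
  have : Nonempty (LineTuple F 4 0) := by
    obtain ⟨w, -⟩ := LineTuple.exists_isSpannedBy (F := F) (n := 4) (l := 0) (W := fun _ _ => 1)
      (fun _ h => one_ne_zero (congrFun h 0)) (fun i j h => (h (Subsingleton.elim (α := Fin 1) i j)).elim)
    exact ⟨w⟩
  have hexact : (augLineCoinvariants (ULift.{u} ℤ) F 4).ExactAt p := by
    match p, hp with
    | 0, _ => exact augLineCoinvariants_exactAt_zero _
    | 1, _ => exact augLineCoinvariants_exactAt_one _ LineTuple.exists_smul_eq_of_single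
    | l + 2, hl => exact augLineCoinvariants_exactAt _ (cocyclesAreCoboundaries (by omega))
  exact hexact.isZero_homology.of_iso
    (HomologicalComplex.homologyMapIso (pageOneRowZeroIso (ULift.{u} ℤ) F 4) p)
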